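/- Let $n\in\mathbb N$, let $H$ be a complex Hilbert space and let $B(H)$ be the bounded operators on $H$ with the operator norm. Write $\langle\xi\rangle=\sqrt{1+|\xi|^2}$ for $\xi\in\mathbb R^n$, with $|\cdot|$ the Euclidean norm. Let $\sigma:\mathbb R^n\times\mathbb R^n\to B(H)$ be such that $\xi\mapsto\sigma(x,\xi)$ is $[n/2]+2$ times differentiable in operator norm for every $x$. Suppose that there are a non-decreasing function $\omega:[0,\infty)\to[0,\infty)$ and constants $C_\alpha$ such that, for all multi-indices $\alpha$ with $|\alpha|\le[n/2]+2$ and all $x,x',\xi\in\mathbb R^n$, $$\|\partial_\xi^\alpha\sigma(x,\xi)\|_{B(H)}\le C_\alpha\langle\xi\rangle^{-|\alpha|},\qquad \|\partial_\xi^\alpha\sigma(x,\xi)-\partial_\xi^\alpha\sigma(x',\xi)\|_{B(H)}\le C_\alpha\langle\xi\rangle^{-|\alpha|}\,\omega(|x-x'|),$$ and that $\int_0^1\omega(t)^2\,\frac{dt}{t}<\infty$. Then the pseudo-differential operator $$T_\sigma f(x)=\frac1{(2\pi)^n}\int_{\mathbb R^n}\sigma(x,\xi)\,\widehat f(\xi)\,e^{ix\cdot\xi}\,d\xi,\qquad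 \widehat f(\xi)=\int_{\mathbb R^n}f(y)\,e^{-iy\cdot\xi}\,dy,\qquad f\in\mathcal S(\mathbb R^n;H),$$ extends to a bounded linear operator on $L_2(\mathbb R^n;H)$. -/

import Mathlib

open MeasureTheory
open scoped SchwartzMap

noncomputable section

/-- The partial derivative `∂_j f`. -/
def partialD {n : ℕ} {F : Type*} [NormedAddCommGroup F] [NormedSpace ℝ F] (j : Fin n)
    (f : EuclideanSpace ℝ (Fin n) → F) : EuclideanSpace ℝ (Fin n) → F :=
  fun ξ => lineDeriv ℝ f ξ (EuclideanSpace.single j 1)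

/-- The length `|α|` of a multi-index. -/
def multiLength {n : ℕ} (α : Fin n → ℕ) : ℕ := ∑ j, α j

/-- The partial derivative `∂^α f = ∂_1^{α_1} ⋯ ∂_n^{α_n} f`. -/
def multiD {n : ℕ} {F : Type*} [NormedAddCommGroup F] [NormedSpace ℝ F] (α : Fin n → ℕ)
    (f : EuclideanSpace ℝ (Fin n) → F) : EuclideanSpace ℝ (Fin n) → F :=
  (List.finRange n).foldr (fun j g => (partialD j)^[α j] g) f

/-- `f` is `k` times (Fréchet) differentiable; the `k`-th derivative need not be continuous. -/
def TimesDifferentiable {n : ℕ} {F : Type*} [NormedAddCommGroup F] [NormedSpace ℝ F] (k : ℕ)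
    (f : EuclideanSpace ℝ (Fin n) → F) : Prop :=
  ∀ m < k, Differentiable ℝ (iteratedFDeriv ℝ m f)

/-- `⟨ξ⟩ = √(1 + |ξ|²)`. -/
def bracket {n : ℕ} (ξ : EuclideanSpace ℝ (Fin n)) : ℝ := √(1 + ‖ξ‖ ^ 2)

/-- The Fourier transform `∫ f(y) e^{-i y·ξ} dy`. -/
def angularFourier {n : ℕ} {H : Type*} [NormedAddCommGroup H] [InnerProductSpace ℂ H]
    (f : EuclideanSpace ℝ (Fin n) → H) (ξ : EuclideanSpace ℝ (Fin n)) : H :=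
  ∫ y, Complex.exp (-(Complex.I * (inner ℝ y ξ : ℝ))) • f y

/-- `T_σ f(x) = (2π)^{-n} ∫ σ(x, ξ) f̂(ξ) e^{i x·ξ} dξ`. -/
def pseudoDiff {n : ℕ} {H : Type*} [NormedAddCommGroup H] [InnerProductSpace ℂ H]
    (σ : EuclideanSpace ℝ (Fin n) → EuclideanSpace ℝ (Fin n) → (H →L[ℂ] H))
    (f : EuclideanSpace ℝ (Fin n) → H) (x : EuclideanSpace ℝ (Fin n)) : H :=
  (((2 * Real.pi) ^ n)⁻¹ : ℝ) •
    ∫ ξ, Complex.exp (Complex.I * (inner ℝ x ξ : ℝ)) • σ x ξ (angularFourier f ξ)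

end

/-!
Cut the symbol with a smooth partition of unity into pieces `b_j(x, ξ)` living on `|ξ| ~ 4ʲ`. For
each frozen `x` the piece is a Fourier multiplier whose kernel, by Plancherel and `N > n / 2`
derivatives in `ξ`, is square integrable against a weight whose inverse is integrable, with a bound
that does not see how the symbol depends on `x`; hence every `T_j` is bounded on `L²` uniformly in
`j`, and it only sees the part of `f` with frequencies `|ξ| ~ 4ʲ`.

To sum over `j`, pair with `g`. If the symbol did not depend on `x`, then `⟨T_j f, g⟩` would only
see the frequencies `|ξ| ~ 4ʲ` of `g` as well. Replacing `g` by this part costs the commutator of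
`T_j` with the frequency projection, whose kernel has width `4⁻ʲ`; at the coarser scale `r = 2⁻ʲ`
the modulus of continuity bounds it by `ω(2⁻ʲ) + 2⁻ʲ`, which is square summable by the Dini
condition. Cauchy–Schwarz in `j` and the almost orthogonality of the frequency parts of `f` and `g`
finish the estimate.
-/

section

open scoped FourierTransform ENNReal NNReal InnerProductSpace

section SquareIntegrable

variable {α E : Type*} [MeasurableSpace α] {μ : Measure α} [NormedAddCommGroup E]

theorem eLpNorm_two_sq (f : α → E) : eLpNorm f 2 μ ^ 2 = ∫⁻ x, ‖f x‖ₑ ^ 2 ∂μ := by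
  have h := eLpNorm_nnreal_pow_eq_lintegral (p := 2) (f := f) (μ := μ) two_ne_zero
  simpa using h

theorem sq_lintegral_mul_le_weighted {f g w : α → ℝ≥0∞} (hf : AEMeasurable f μ)
    (hg : AEMeasurable g μ) (hw : AEMeasurable w μ) (hw₀ : ∀ a, w a ≠ 0) (hw_top : ∀ a, w a ≠ ⊤) :
    (∫⁻ a, f a * g a ∂μ) ^ 2 ≤ (∫⁻ a, (w a)⁻¹ * f a ^ 2 ∂μ) * ∫⁻ a, w a * g a ^ 2 ∂μ := by
  have root_mul_root (a) : (w a)⁻¹ ^ (1 / 2 : ℝ) * w a ^ (1 / 2 : ℝ) = 1 := by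
    rw [← ENNReal.mul_rpow_of_nonneg _ _ (by norm_num), ENNReal.inv_mul_cancel (hw₀ a) (hw_top a),
      ENNReal.one_rpow]
  have holder := pow_le_pow_left' (ENNReal.lintegral_mul_le_Lp_mul_Lq μ Real.HolderConjugate.two_two
    ((hw.inv.pow_const (1 / 2 : ℝ)).mul hf) ((hw.pow_const (1 / 2 : ℝ)).mul hg)) 2
  calc (∫⁻ a, f a * g a ∂μ) ^ 2
      = (∫⁻ a, ((w a)⁻¹ ^ (1 / 2 : ℝ) * f a) * (w a ^ (1 / 2 : ℝ) * g a) ∂μ) ^ 2 := by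
        congr 2 with a
        rw [mul_mul_mul_comm, root_mul_root, one_mul]
    _ ≤ _ := by
        simp only [Pi.mul_apply, mul_pow, ← ENNReal.rpow_natCast, ← ENNReal.rpow_mul,
          ENNReal.mul_rpow_of_nonneg _ _ (zero_le_two (α := ℝ)), Nat.cast_ofNat] at holder ⊢
        norm_num at holder ⊢
        exact holder

theorem enorm_inner_le {𝕜 : Type*} [RCLike 𝕜] [InnerProductSpace 𝕜 E] (v w : E) :
    ‖inner 𝕜 v w‖ₑ ≤ ‖v‖ₑ * ‖w‖ₑ := by
  simp only [enorm_eq_nnnorm]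
  exact_mod_cast nnnorm_inner_le_nnnorm v w

theorem enorm_integral_inner_le {𝕜 : Type*} [RCLike 𝕜] [InnerProductSpace 𝕜 E] {f g : α → E}
    (hf : AEStronglyMeasurable f μ) (hg : AEStronglyMeasurable g μ) :
    ‖∫ x, inner 𝕜 (f x) (g x) ∂μ‖ₑ ≤ eLpNorm f 2 μ * eLpNorm g 2 μ := by
  calc ‖∫ x, inner 𝕜 (f x) (g x) ∂μ‖ₑ ≤ eLpNorm (fun x => inner 𝕜 (f x) (g x)) 1 μ := by
        rw [eLpNorm_one_eq_lintegral_enorm]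
        exact enorm_integral_le_lintegral_enorm _
    _ ≤ (1 : ℝ≥0) * eLpNorm f 2 μ * eLpNorm g 2 μ :=
        eLpNorm_le_eLpNorm_mul_eLpNorm_of_nnnorm hf hg (inner 𝕜) 1
          (.of_forall fun x => by simpa using nnnorm_inner_le_nnnorm (𝕜 := 𝕜) (f x) (g x))
    _ = _ := by simp

theorem integral_inner_left {𝕜 : Type*} [RCLike 𝕜] [InnerProductSpace 𝕜 E] [NormedSpace ℝ E]
    [CompleteSpace E] {f : α → E} (hf : Integrable f μ) (v : E) :
    ∫ x, inner 𝕜 (f x) v ∂μ = inner 𝕜 (∫ x, f x ∂μ) v := by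
  simp only [← inner_conj_symm _ v, integral_conj, integral_inner hf]

theorem sum_mul_le_of_sum_sq_le {ι : Type*} {s : Finset ι} {a b : ι → ℝ≥0∞} {A B : ℝ≥0∞}
    (ha : ∑ i ∈ s, a i ^ 2 ≤ A ^ 2) (hb : ∑ i ∈ s, b i ^ 2 ≤ B ^ 2) :
    ∑ i ∈ s, a i * b i ≤ A * B := by
  have root {c : ι → ℝ≥0∞} {C : ℝ≥0∞} (hc : ∑ i ∈ s, c i ^ 2 ≤ C ^ 2) :
      (∑ i ∈ s, c i ^ (2 : ℝ)) ^ (1 / 2 : ℝ) ≤ C := by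
    rw [one_div, ENNReal.rpow_inv_le_iff two_pos]
    simpa only [ENNReal.rpow_two] using hc
  exact (ENNReal.inner_le_Lp_mul_Lq s a b Real.HolderConjugate.two_two).trans
    (mul_le_mul' (root ha) (root hb))

end SquareIntegrable

section Fourier

open scoped ContDiff

variable {V : Type*} [NormedAddCommGroup V] [InnerProductSpace ℝ V] [FiniteDimensional ℝ V]
  [MeasurableSpace V] [BorelSpace V]

theorem continuous_fourier {E : Type*} [NormedAddCommGroup E] [NormedSpace ℂ E] {f : V → E}
    (hf : Integrable f) : Continuous (𝓕 f) :=
  VectorFourier.fourierIntegral_continuous Real.continuous_fourierChar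
    (innerSL ℝ).continuous₂ hf

theorem fourier_comp_add_right {E : Type*} [NormedAddCommGroup E] [NormedSpace ℂ E] (f : V → E)
    (x ξ : V) : 𝓕 (fun y => f (y + x)) ξ = Real.fourierChar (inner ℝ ξ x) • 𝓕 f ξ := by
  rw [real_inner_comm]
  exact congrFun (VectorFourier.fourierIntegral_comp_add_right Real.fourierChar volume
    (innerₗ V) f x) ξ

theorem integral_fourier_smul {E : Type*} [NormedAddCommGroup E] [NormedSpace ℂ E]
    [CompleteSpace E] {φ : V → ℂ} {f : V → E} (hφ : Integrable φ) (hf : Integrable f) :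
    ∫ x, 𝓕 φ x • f x = ∫ x, φ x • 𝓕 f x := by
  have h := VectorFourier.integral_fourierIntegral_smul_eq_flip (μ := volume) (ν := volume)
    (L := innerₗ V) Real.continuous_fourierChar (innerSL ℝ).continuous₂ hφ hf
  rwa [flip_innerₗ] at h

variable {F : Type*} [NormedAddCommGroup F] [InnerProductSpace ℂ F] [CompleteSpace F]

theorem fourier_toLp_ae_eq {f : V → F} (hf : Integrable f) (hf2 : MemLp f 2) :
    (𝓕 (hf2.toLp f) : Lp F 2 (volume : Measure V)) =ᵐ[volume] 𝓕 f := by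
  refine ae_eq_of_integral_contDiff_smul_eq ((Lp.memLp _).locallyIntegrable one_le_two)
    (continuous_fourier hf).locallyIntegrable fun g hg hgc => ?_
  have hgC : ContDiff ℝ ∞ (fun x => (g x : ℂ)) := Complex.ofRealCLM.contDiff.comp hg
  have hgCc : HasCompactSupport (fun x => (g x : ℂ)) :=
    hgc.comp_left (g := fun r : ℝ => (r : ℂ)) Complex.ofReal_zero
  let φ : 𝓢(V, ℂ) := hgCc.toSchwartzMap hgC
  have weak_eq := congrArg (fun T : 𝓢'(V, F) => T φ)
    (Lp.fourier_toTemperedDistribution_eq (hf2.toLp f))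
  simp only [TemperedDistribution.fourier_apply, Lp.toTemperedDistribution_apply] at weak_eq
  have smul_g (h : V → F) (x : V) : g x • h x = φ x • h x := (Complex.coe_smul (g x) (h x)).symm
  calc ∫ x, g x • (𝓕 (hf2.toLp f) : Lp F 2 (volume : Measure V)) x
      = ∫ x, (𝓕 φ) x • (hf2.toLp f : V → F) x := by simp only [smul_g, weak_eq]
    _ = ∫ x, 𝓕 (φ : V → ℂ) x • f x := by
        rw [SchwartzMap.fourier_coe]
        refine integral_congr_ae ?_
        filter_upwards [hf2.coeFn_toLp] with x hx
        rw [hx]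
    _ = ∫ x, g x • 𝓕 f x := by simp only [smul_g, integral_fourier_smul φ.integrable hf]

theorem eLpNorm_fourier {f : V → F} (hf : Integrable f) (hf2 : MemLp f 2) :
    eLpNorm (𝓕 f) 2 volume = eLpNorm f 2 volume := by
  rw [← eLpNorm_congr_ae (fourier_toLp_ae_eq hf hf2), ← Lp.enorm_def, ← ofReal_norm,
    Lp.norm_fourier_eq, ofReal_norm, Lp.enorm_def, eLpNorm_congr_ae hf2.coeFn_toLp]

theorem lintegral_fourier_sq {f : V → F} (hf : Continuous f) (hfc : HasCompactSupport f) :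
    ∫⁻ z, ‖𝓕 f z‖ₑ ^ 2 = eLpNorm f 2 volume ^ 2 := by
  rw [← eLpNorm_two_sq, eLpNorm_fourier (hf.integrable_of_hasCompactSupport hfc)
    (hf.memLp_of_hasCompactSupport hfc)]

theorem integral_inner_fourier {f g : V → F} (hf : Integrable f) (hg : Integrable g) :
    ∫ ξ, ⟪𝓕 f ξ, g ξ⟫_ℂ = ∫ x, ⟪f x, 𝓕⁻ g x⟫_ℂ := by
  have h := VectorFourier.integral_sesq_fourierIntegral_eq_neg_flip (μ := volume) (ν := volume)
    (L := innerₗ V) (innerSL ℂ (E := F)) Real.continuous_fourierChar (innerSL ℝ).continuous₂ hf hg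
  rwa [flip_innerₗ] at h

end Fourier

theorem lintegral_comp_smul_of_pos {V : Type*} [NormedAddCommGroup V] [NormedSpace ℝ V]
    [FiniteDimensional ℝ V] [MeasurableSpace V] [BorelSpace V] (μ : Measure V)
    [μ.IsAddHaarMeasure] (f : V → ℝ≥0∞) {R : ℝ} (hR : 0 < R) :
    ∫⁻ x, f (R • x) ∂μ = ENNReal.ofReal (R ^ Module.finrank ℝ V)⁻¹ * ∫⁻ x, f x ∂μ := by
  calc ∫⁻ x, f (R • x) ∂μ = ∫⁻ x, f x ∂(μ.map (R • ·)) :=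
        (lintegral_map_equiv f (Homeomorph.smulOfNeZero R hR.ne').toMeasurableEquiv).symm
    _ = _ := by
        rw [Measure.map_addHaar_smul μ hR.ne', lintegral_smul_measure, abs_of_pos (by positivity),
          smul_eq_mul]

section Multiplier

variable {V F G : Type*} [NormedAddCommGroup V] [InnerProductSpace ℝ V] [FiniteDimensional ℝ V]
  [MeasurableSpace V] [BorelSpace V] [NormedAddCommGroup F] [InnerProductSpace ℂ F]
  [NormedAddCommGroup G] [InnerProductSpace ℂ G]

/-- The Fourier multiplier `𝓕⁻ (b 𝓕 f)` with operator-valued symbol `b`. A pseudo-differential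
operator is `x ↦ multOp (σ x) f x`: freezing `x` in the symbol first lets kernel estimates be made
for each multiplier separately. -/
noncomputable def multOp (b : V → (F →L[ℂ] G)) (f : V → F) : V → G :=
  𝓕⁻ (fun ξ => b ξ (𝓕 f ξ))

theorem multOp_apply (b : V → (F →L[ℂ] G)) (f : V → F) (x : V) :
    multOp b f x = ∫ ξ, Real.fourierChar (inner ℝ ξ x) • b ξ (𝓕 f ξ) :=
  Real.fourierInv_eq _ _

theorem integrable_apply_fourier {b : V → (F →L[ℂ] G)} (hb : Continuous b)
    (hbc : HasCompactSupport b) {f : V → F} (hf : Integrable f) :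
    Integrable fun ξ => b ξ (𝓕 f ξ) :=
  (hb.clm_apply (continuous_fourier hf)).integrable_of_hasCompactSupport
    (hbc.mono fun ξ hξ h => hξ (by simp [h]))

variable [CompleteSpace F] [CompleteSpace G]

/-- The map `B ↦ B* v`. It is only real linear, but that is enough to commute with derivatives. -/
noncomputable def adjointApply (v : G) : (F →L[ℂ] G) →L[ℝ] F :=
  AddMonoidHom.toRealLinearMap
    { toFun := fun B => ContinuousLinearMap.adjoint B v
      map_zero' := by simp
      map_add' := fun B C => by simp }
    ((ContinuousLinearMap.apply ℂ F v).continuous.comp ContinuousLinearMap.adjoint.continuous)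

theorem adjointApply_apply (v : G) (B : F →L[ℂ] G) :
    adjointApply v B = ContinuousLinearMap.adjoint B v := rfl

theorem norm_adjointApply_le (v : G) : ‖(adjointApply v : (F →L[ℂ] G) →L[ℝ] F)‖ ≤ ‖v‖ :=
  ContinuousLinearMap.opNorm_le_bound _ (norm_nonneg v) fun B =>
    ((ContinuousLinearMap.adjoint B).le_opNorm v).trans_eq
      (by rw [LinearIsometryEquiv.norm_map, mul_comm])

theorem inner_multOp_eq_integral_kernel {b : V → (F →L[ℂ] G)} (hb : Continuous b)
    (hbc : HasCompactSupport b) {f : V → F} (hf : Integrable f) (x : V) (v : G) :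
    ⟪multOp b f x, v⟫_ℂ = ∫ y, ⟪f y, 𝓕 (fun ξ => adjointApply v (b ξ)) (x - y)⟫_ℂ := by
  have hm : Integrable fun ξ => adjointApply v (b ξ) :=
    ((adjointApply v).continuous.comp hb).integrable_of_hasCompactSupport
      (hbc.comp_left (map_zero _))
  have hbf : Integrable fun ξ => Real.fourierChar (inner ℝ ξ x) • b ξ (𝓕 f ξ) := by
    simpa using (Real.fourierIntegral_convergent_iff (V := V) (-x)).2
      (integrable_apply_fourier hb hbc hf)
  calc ⟪multOp b f x, v⟫_ℂ
      = ∫ ξ, ⟪Real.fourierChar (inner ℝ ξ x) • b ξ (𝓕 f ξ), v⟫_ℂ := by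
        rw [multOp_apply, integral_inner_left hbf]
    _ = ∫ ξ, ⟪𝓕 (fun y => f (y + x)) ξ, adjointApply v (b ξ)⟫_ℂ := by
        congr 1 with ξ
        rw [fourier_comp_add_right, adjointApply_apply, ContinuousLinearMap.adjoint_inner_right,
          Circle.smul_def, Circle.smul_def, map_smul]
    _ = ∫ y, ⟪f (y + x), 𝓕⁻ (fun ξ => adjointApply v (b ξ)) y⟫_ℂ :=
        integral_inner_fourier (hf.comp_add_right x) hm
    _ = _ := by
        rw [← integral_add_right_eq_self
          (fun y => ⟪f y, 𝓕 (fun ξ => adjointApply v (b ξ)) (x - y)⟫_ℂ) x]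
        simp only [Real.fourierInv_eq_fourier_neg, sub_add_cancel_right]

theorem enorm_multOp_sq_le_of_kernel {b : V → (F →L[ℂ] G)} (hb : Continuous b)
    (hbc : HasCompactSupport b) {w : V → ℝ≥0∞} (hw : Measurable w) (hw₀ : ∀ z, w z ≠ 0)
    (hw_top : ∀ z, w z ≠ ⊤) {M : ℝ≥0∞}
    (hM : ∀ v, ∫⁻ z, w z * ‖𝓕 (fun ξ => adjointApply v (b ξ)) z‖ₑ ^ 2 ≤ ‖v‖ₑ ^ 2 * M)
    {f : V → F} (hf : Integrable f) (x : V) :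
    ‖multOp b f x‖ₑ ^ 2 ≤ M * ∫⁻ y, (w (x - y))⁻¹ * ‖f y‖ₑ ^ 2 := by
  set v := multOp b f x with hv
  set κ := 𝓕 (fun ξ => adjointApply v (b ξ)) with hκ
  have hκ_cont : Continuous κ := continuous_fourier
    (((adjointApply v).continuous.comp hb).integrable_of_hasCompactSupport
      (hbc.comp_left (map_zero _)))
  have pair : ‖v‖ₑ ^ 2 ≤ ∫⁻ y, ‖f y‖ₑ * ‖κ (x - y)‖ₑ := by
    calc ‖v‖ₑ ^ 2 = ‖⟪v, v⟫_ℂ‖ₑ := by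
          simp [inner_self_eq_norm_sq_to_K, enorm_eq_nnnorm]
      _ ≤ ∫⁻ y, ‖⟪f y, κ (x - y)⟫_ℂ‖ₑ := by
        rw [hv, inner_multOp_eq_integral_kernel hb hbc hf, ← hv, ← hκ]
        exact enorm_integral_le_lintegral_enorm _
      _ ≤ _ := lintegral_mono fun y => enorm_inner_le _ _
  have sq_sq : ‖v‖ₑ ^ 2 * ‖v‖ₑ ^ 2 ≤ ‖v‖ₑ ^ 2 * (M * ∫⁻ y, (w (x - y))⁻¹ * ‖f y‖ₑ ^ 2) := by
    calc ‖v‖ₑ ^ 2 * ‖v‖ₑ ^ 2 ≤ (∫⁻ y, ‖f y‖ₑ * ‖κ (x - y)‖ₑ) ^ 2 := by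
          rw [← sq]
          exact pow_le_pow_left' pair 2
      _ ≤ (∫⁻ y, (w (x - y))⁻¹ * ‖f y‖ₑ ^ 2) * ∫⁻ y, w (x - y) * ‖κ (x - y)‖ₑ ^ 2 :=
          sq_lintegral_mul_le_weighted hf.1.enorm
            (hκ_cont.comp (continuous_sub_left x)).enorm.measurable.aemeasurable
            (hw.comp (measurable_const_sub x)).aemeasurable (fun y => hw₀ _) fun y => hw_top _
      _ ≤ (∫⁻ y, (w (x - y))⁻¹ * ‖f y‖ₑ ^ 2) * (‖v‖ₑ ^ 2 * M) := by
          rw [lintegral_sub_left_eq_self (fun z => w z * ‖κ z‖ₑ ^ 2) x]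
          exact mul_le_mul_right (hM v) _
      _ = _ := by ring
  rcases eq_or_ne v 0 with h0 | h0
  · simp [h0]
  · exact (ENNReal.mul_le_mul_iff_right (by simpa using h0) (by simp)).1 sq_sq

theorem eLpNorm_multOp_sq_le_of_kernel {b : V → V → (F →L[ℂ] G)} (hb : ∀ x, Continuous (b x))
    (hbc : ∀ x, HasCompactSupport (b x)) {w : V → ℝ≥0∞} (hw : Measurable w) (hw₀ : ∀ z, w z ≠ 0)
    (hw_top : ∀ z, w z ≠ ⊤) {M : ℝ≥0∞}
    (hM : ∀ x v, ∫⁻ z, w z * ‖𝓕 (fun ξ => adjointApply v (b x ξ)) z‖ₑ ^ 2 ≤ ‖v‖ₑ ^ 2 * M)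
    (f : 𝓢(V, F)) (u : V) :
    eLpNorm (fun x => multOp (b x) f (x - u)) 2 volume ^ 2 ≤
      M * (∫⁻ z, (w z)⁻¹) * eLpNorm f 2 volume ^ 2 := by
  have hfm : Measurable fun y => ‖f y‖ₑ ^ 2 := f.continuous.enorm.measurable.pow_const 2
  have hwm : Measurable fun p : V × V => (w (p.1 - u - p.2))⁻¹ := (hw.comp (by fun_prop)).inv
  calc eLpNorm (fun x => multOp (b x) f (x - u)) 2 volume ^ 2
      = ∫⁻ x, ‖multOp (b x) f (x - u)‖ₑ ^ 2 := eLpNorm_two_sq _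
    _ ≤ ∫⁻ x, M * ∫⁻ y, (w (x - u - y))⁻¹ * ‖f y‖ₑ ^ 2 := lintegral_mono fun x =>
        enorm_multOp_sq_le_of_kernel (hb x) (hbc x) hw hw₀ hw_top (hM x) f.integrable (x - u)
    _ = M * ∫⁻ y, (∫⁻ x, (w (x - u - y))⁻¹) * ‖f y‖ₑ ^ 2 := by
        have hmeas : Measurable fun p : V × V => (w (p.1 - u - p.2))⁻¹ * ‖f p.2‖ₑ ^ 2 :=
          hwm.mul (hfm.comp measurable_snd)
        rw [lintegral_const_mul _ hmeas.lintegral_prod_right',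
          lintegral_lintegral_swap hmeas.aemeasurable]
        congr 2 with y
        exact lintegral_mul_const (‖f y‖ₑ ^ 2) (hwm.comp (measurable_prodMk_right (y := y)))
    _ = M * ∫⁻ y, (∫⁻ z, (w z)⁻¹) * ‖f y‖ₑ ^ 2 := by
        congr 2 with y
        simp only [sub_sub, lintegral_sub_right_eq_self (fun z => (w z)⁻¹) (u + y)]
    _ = _ := by rw [lintegral_const_mul _ hfm, mul_assoc, eLpNorm_two_sq]

end Multiplier

section PureDerivatives

variable {n : ℕ} {F : Type*} [NormedAddCommGroup F] [NormedSpace ℝ F]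

theorem iterate_partialD_add_smul_single (i : Fin n) (k : ℕ) (f : EuclideanSpace ℝ (Fin n) → F)
    (ξ : EuclideanSpace ℝ (Fin n)) (s : ℝ) :
    (partialD i)^[k] f (ξ + s • EuclideanSpace.single i 1) =
      iteratedDeriv k (fun t : ℝ => f (ξ + t • EuclideanSpace.single i 1)) s := by
  induction k generalizing s with
  | zero => simp
  | succ k ih =>
    rw [Function.iterate_succ_apply', iteratedDeriv_succ, partialD, lineDeriv]
    simp only [add_assoc, ← add_smul, ih]
    rw [deriv_comp_const_add (f := iteratedDeriv k _), add_zero]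

theorem iterate_partialD_eq_iteratedDeriv (i : Fin n) (k : ℕ)
    (f : EuclideanSpace ℝ (Fin n) → F) (ξ : EuclideanSpace ℝ (Fin n)) :
    (partialD i)^[k] f ξ =
      iteratedDeriv k (fun t : ℝ => f (ξ + t • EuclideanSpace.single i 1)) 0 := by
  simpa using iterate_partialD_add_smul_single i k f ξ 0

theorem contDiff_comp_add_smul {f : EuclideanSpace ℝ (Fin n) → F} {k : ℕ} (hf : ContDiff ℝ k f)
    (ξ v : EuclideanSpace ℝ (Fin n)) : ContDiff ℝ k (fun t : ℝ => f (ξ + t • v)) :=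
  hf.comp (by fun_prop)

theorem partialD_eq_fderiv {f : EuclideanSpace ℝ (Fin n) → F} (hf : Differentiable ℝ f)
    (i : Fin n) : partialD i f = fun ξ => fderiv ℝ f ξ (EuclideanSpace.single i 1) :=
  funext fun ξ => (hf ξ).lineDeriv_eq_fderiv

theorem contDiff_partialD {f : EuclideanSpace ℝ (Fin n) → F} {k : ℕ}
    (hf : ContDiff ℝ (k + 1 : ℕ) f) (i : Fin n) : ContDiff ℝ k (partialD i f) := by
  rw [partialD_eq_fderiv (hf.differentiable (by simp))]
  exact (hf.fderiv_right (by norm_cast)).clm_apply contDiff_const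

theorem continuous_iterate_partialD {f : EuclideanSpace ℝ (Fin n) → F} {k : ℕ}
    (hf : ContDiff ℝ k f) (i : Fin n) : Continuous ((partialD i)^[k] f) := by
  induction k generalizing f with
  | zero => exact hf.continuous
  | succ k ih => exact ih (contDiff_partialD hf i)

theorem support_iterate_partialD_subset (f : EuclideanSpace ℝ (Fin n) → F) (i : Fin n) (k : ℕ) :
    Function.support ((partialD i)^[k] f) ⊆ tsupport f := by
  refine Function.support_subset_iff'.2 fun ξ hξ => ?_
  have tendsto_line : Filter.Tendsto (fun t : ℝ => ξ + t • EuclideanSpace.single i (1 : ℝ))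
      (nhds 0) (nhds ξ) :=
    Continuous.tendsto' (by fun_prop) _ _ (by simp)
  have line_eq_zero : (fun t : ℝ => f (ξ + t • EuclideanSpace.single i 1)) =ᶠ[nhds 0] 0 :=
    tendsto_line.eventually (notMem_tsupport_iff_eventuallyEq.1 hξ)
  rw [iterate_partialD_eq_iteratedDeriv, line_eq_zero.iteratedDeriv_eq]
  simp

theorem hasCompactSupport_iterate_partialD {f : EuclideanSpace ℝ (Fin n) → F}
    (hc : HasCompactSupport f) (i : Fin n) (k : ℕ) : HasCompactSupport ((partialD i)^[k] f) :=
  hc.mono' (support_iterate_partialD_subset f i k)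

theorem iterate_partialD_sub {f g : EuclideanSpace ℝ (Fin n) → F} {k : ℕ} (hf : ContDiff ℝ k f)
    (hg : ContDiff ℝ k g) (i : Fin n) (ξ : EuclideanSpace ℝ (Fin n)) :
    (partialD i)^[k] (fun η => f η - g η) ξ = (partialD i)^[k] f ξ - (partialD i)^[k] g ξ := by
  simp only [iterate_partialD_eq_iteratedDeriv]
  exact iteratedDeriv_fun_sub (contDiff_comp_add_smul hf _ _).contDiffAt
    (contDiff_comp_add_smul hg _ _).contDiffAt

theorem iterate_partialD_comp_smul {f : EuclideanSpace ℝ (Fin n) → F} {k : ℕ}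
    (hf : ContDiff ℝ k f) (c : ℝ) (i : Fin n) (ξ : EuclideanSpace ℝ (Fin n)) :
    (partialD i)^[k] (fun η => f (c • η)) ξ = c ^ k • (partialD i)^[k] f (c • ξ) := by
  simp only [iterate_partialD_eq_iteratedDeriv, smul_add, smul_smul]
  simpa using congrFun (iteratedDeriv_comp_const_smul (contDiff_comp_add_smul hf (c • ξ)
    (EuclideanSpace.single i (1 : ℝ))) c) 0

theorem norm_iterate_partialD_smul_le {φ : EuclideanSpace ℝ (Fin n) → ℝ}
    {f : EuclideanSpace ℝ (Fin n) → F} {k : ℕ} (hφ : ContDiff ℝ k φ) (hf : ContDiff ℝ k f)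
    (i : Fin n) (ξ : EuclideanSpace ℝ (Fin n)) :
    ‖(partialD i)^[k] (fun η => φ η • f η) ξ‖ ≤ ∑ l ∈ Finset.range (k + 1),
      (k.choose l : ℝ) * ‖(partialD i)^[l] φ ξ‖ * ‖(partialD i)^[k - l] f ξ‖ := by
  simp only [iterate_partialD_eq_iteratedDeriv, ← norm_iteratedFDeriv_eq_norm_iteratedDeriv]
  exact norm_iteratedFDeriv_smul_le (contDiff_comp_add_smul hφ _ _)
    (contDiff_comp_add_smul hf _ _) 0 le_rfl

theorem norm_iterate_partialD_clm_comp_le {G : Type*} [NormedAddCommGroup G] [NormedSpace ℝ G]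
    (L : F →L[ℝ] G) {f : EuclideanSpace ℝ (Fin n) → F} {k : ℕ} (hf : ContDiff ℝ k f) (i : Fin n)
    (ξ : EuclideanSpace ℝ (Fin n)) :
    ‖(partialD i)^[k] (fun η => L (f η)) ξ‖ ≤ ‖L‖ * ‖(partialD i)^[k] f ξ‖ := by
  simp only [iterate_partialD_eq_iteratedDeriv, ← norm_iteratedFDeriv_eq_norm_iteratedDeriv]
  exact L.norm_iteratedFDeriv_comp_left (contDiff_comp_add_smul hf _ _).contDiffAt le_rfl

theorem fourier_partialD {E : Type*} [NormedAddCommGroup E] [NormedSpace ℂ E]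
    {f : EuclideanSpace ℝ (Fin n) → E} (hf : ContDiff ℝ 1 f) (hc : HasCompactSupport f)
    (i : Fin n) (z : EuclideanSpace ℝ (Fin n)) :
    𝓕 (partialD i f) z = (2 * Real.pi * Complex.I * z i) • 𝓕 f z := by
  have hd : Differentiable ℝ f := hf.differentiable one_ne_zero
  have hfi : Integrable (fderiv ℝ f) :=
    (hf.continuous_fderiv one_ne_zero).integrable_of_hasCompactSupport (hc.fderiv ℝ)
  rw [partialD_eq_fderiv hd, ← Real.fourier_continuousLinearMap_apply hfi,
    Real.fourier_fderiv (hd.continuous.integrable_of_hasCompactSupport hc) hd hfi]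
  have inner_single : innerSL ℝ z (EuclideanSpace.single i 1) = z i := by
    simp [innerSL_apply_apply ℝ z, EuclideanSpace.inner_single_right]
  simp [VectorFourier.fourierSMulRight_apply, inner_single, smul_smul, ← Complex.coe_smul]

theorem fourier_iterate_partialD {E : Type*} [NormedAddCommGroup E] [NormedSpace ℂ E]
    {f : EuclideanSpace ℝ (Fin n) → E} {k : ℕ} (hf : ContDiff ℝ k f) (hc : HasCompactSupport f)
    (i : Fin n) (z : EuclideanSpace ℝ (Fin n)) :
    𝓕 ((partialD i)^[k] f) z = (2 * Real.pi * Complex.I * z i) ^ k • 𝓕 f z := by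
  induction k generalizing f with
  | zero => simp
  | succ k ih =>
    rw [Function.iterate_succ_apply,
      ih (contDiff_partialD hf i) (hasCompactSupport_iterate_partialD hc i 1),
      fourier_partialD (hf.of_le (by simp)) hc, smul_smul, pow_succ]

theorem enorm_coord_pow_mul_fourier_le {E : Type*} [NormedAddCommGroup E] [NormedSpace ℂ E]
    {f : EuclideanSpace ℝ (Fin n) → E} {k : ℕ} (hf : ContDiff ℝ k f) (hc : HasCompactSupport f)
    (i : Fin n) (z : EuclideanSpace ℝ (Fin n)) :
    ‖z i‖ₑ ^ k * ‖𝓕 f z‖ₑ ≤ ‖𝓕 ((partialD i)^[k] f) z‖ₑ := by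
  rw [fourier_iterate_partialD hf hc, enorm_smul, enorm_pow]
  gcongr
  rw [enorm_le_iff_norm_le]
  simpa [abs_of_pos Real.pi_pos] using
    le_mul_of_one_le_left (abs_nonneg (z i)) (by linarith [Real.pi_gt_three] : 1 ≤ 2 * Real.pi)

end PureDerivatives

section KernelDecay

variable {n : ℕ}

/-- The weight `1 + ∑ i, |z i| ^ (2 * N)`, comparable to `(1 + ‖z‖) ^ (2 * N)`. It is written in
coordinates because its integral against `|𝓕 m| ^ 2` only involves the pure derivatives
`∂_i ^ N m`. -/
noncomputable def kernelWeight (N : ℕ) (z : EuclideanSpace ℝ (Fin n)) : ℝ≥0∞ :=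
  1 + ∑ i, ‖z i‖ₑ ^ (2 * N)

theorem measurable_kernelWeight (N : ℕ) :
    Measurable (kernelWeight N : EuclideanSpace ℝ (Fin n) → ℝ≥0∞) := by
  unfold kernelWeight
  fun_prop

theorem kernelWeight_ne_zero (N : ℕ) (z : EuclideanSpace ℝ (Fin n)) : kernelWeight N z ≠ 0 := by
  simp [kernelWeight]

theorem kernelWeight_ne_top (N : ℕ) (z : EuclideanSpace ℝ (Fin n)) : kernelWeight N z ≠ ⊤ := by
  simp [kernelWeight, ENNReal.sum_eq_top]

theorem kernelWeight_eq_ofReal (N : ℕ) (z : EuclideanSpace ℝ (Fin n)) :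
    kernelWeight N z = ENNReal.ofReal (1 + ∑ i, (z i ^ 2) ^ N) := by
  rw [ENNReal.ofReal_add zero_le_one (by positivity),
    ENNReal.ofReal_sum_of_nonneg (fun i _ => by positivity)]
  simp only [kernelWeight, ENNReal.ofReal_one, Real.enorm_eq_ofReal_abs, pow_mul,
    ← ENNReal.ofReal_pow (abs_nonneg _), sq_abs]

theorem one_add_norm_sq_pow_le (M : ℕ) (z : EuclideanSpace ℝ (Fin n)) :
    (1 + ‖z‖ ^ 2) ^ (M + 1) ≤ (n + 1) ^ M * (1 + ∑ i, (z i ^ 2) ^ (M + 1)) := by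
  have h := pow_sum_div_card_le_sum_pow (s := Finset.univ)
    (f := fun o : Option (Fin n) => o.elim 1 (z · ^ 2))
    (fun o _ => by cases o <;> simp [sq_nonneg]) M
  have card_eq : (Finset.univ : Finset (Option (Fin n))).card = n + 1 := by simp
  rw [card_eq, div_le_iff₀' (by positivity)] at h
  simpa [Fintype.sum_option, EuclideanSpace.norm_sq_eq] using h

theorem lintegral_inv_kernelWeight_lt_top {N : ℕ} (hN : n < 2 * N) :
    ∫⁻ z : EuclideanSpace ℝ (Fin n), (kernelWeight N z)⁻¹ < ⊤ := by
  obtain ⟨M, rfl⟩ : ∃ M, N = M + 1 := ⟨N - 1, by omega⟩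
  set K : ℝ := 2 ^ (M + 1) * (n + 1) ^ M with hK
  have weight_ge (z : EuclideanSpace ℝ (Fin n)) :
      (1 + ‖z‖) ^ (2 * (M + 1)) ≤ K * (1 + ∑ i, (z i ^ 2) ^ (M + 1)) := by
    calc (1 + ‖z‖) ^ (2 * (M + 1)) = ((1 + ‖z‖) ^ 2) ^ (M + 1) := pow_mul _ _ _
      _ ≤ (2 * (1 + ‖z‖ ^ 2)) ^ (M + 1) := by
          gcongr
          linarith [sq_nonneg (1 - ‖z‖)]
      _ = 2 ^ (M + 1) * (1 + ‖z‖ ^ 2) ^ (M + 1) := mul_pow _ _ _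
      _ ≤ 2 ^ (M + 1) * ((n + 1) ^ M * (1 + ∑ i, (z i ^ 2) ^ (M + 1))) := by
          gcongr
          exact one_add_norm_sq_pow_le M z
      _ = K * (1 + ∑ i, (z i ^ 2) ^ (M + 1)) := by rw [hK, mul_assoc]
  have inv_weight_le (z : EuclideanSpace ℝ (Fin n)) : (kernelWeight (M + 1) z)⁻¹ ≤
      ENNReal.ofReal K * ENNReal.ofReal ((1 + ‖z‖) ^ (-((2 * (M + 1) : ℕ) : ℝ))) := by
    rw [kernelWeight_eq_ofReal, ← ENNReal.ofReal_inv_of_pos (by positivity),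
      ← ENNReal.ofReal_mul (by positivity), Real.rpow_neg (by positivity), Real.rpow_natCast]
    refine ENNReal.ofReal_le_ofReal ?_
    rw [inv_le_iff_one_le_mul₀ (by positivity), mul_right_comm, ← div_eq_mul_inv,
      one_le_div (by positivity)]
    exact weight_ge z
  have finite := finite_integral_one_add_norm
    (μ := (volume : Measure (EuclideanSpace ℝ (Fin n)))) (r := (2 * (M + 1) : ℕ))
    (by simpa using by exact_mod_cast hN)
  calc _ ≤ ∫⁻ z : EuclideanSpace ℝ (Fin n), ENNReal.ofReal K *
          ENNReal.ofReal ((1 + ‖z‖) ^ (-((2 * (M + 1) : ℕ) : ℝ))) := lintegral_mono inv_weight_le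
    _ < ⊤ := by
        rw [lintegral_const_mul _ (by fun_prop)]
        exact ENNReal.mul_lt_top ENNReal.ofReal_lt_top finite

theorem eLpNorm_two_sq_le_of_support {α E : Type*} [MeasurableSpace α] {μ : Measure α}
    [NormedAddCommGroup E] {S : Set α} (hS : MeasurableSet S) {f : α → E}
    (hf : Function.support f ⊆ S) {A : ℝ} (hA : ∀ x, ‖f x‖ ≤ A) :
    eLpNorm f 2 μ ^ 2 ≤ ENNReal.ofReal A ^ 2 * μ S := by
  calc eLpNorm f 2 μ ^ 2 = eLpNorm (S.indicator f) 2 μ ^ 2 := by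
        rw [Set.indicator_eq_self.2 hf]
    _ ≤ (ENNReal.ofReal A * μ S ^ (1 / (2 : ℝ))) ^ 2 := by
        rw [eLpNorm_indicator_eq_eLpNorm_restrict hS]
        gcongr
        simpa [mul_comm] using
          eLpNorm_le_of_ae_bound (p := 2) (μ := μ.restrict S) (.of_forall hA)
    _ = _ := by rw [mul_pow, ← ENNReal.rpow_natCast (_ ^ _), ← ENNReal.rpow_mul]; norm_num

theorem exists_nnreal_le_sq {Q : ℝ≥0∞} (hQ : Q ≠ ⊤) : ∃ K : ℝ≥0, Q ≤ (K : ℝ≥0∞) ^ 2 := by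
  lift Q to ℝ≥0 using hQ
  exact ⟨NNReal.sqrt Q, by rw [← ENNReal.coe_pow, NNReal.sq_sqrt]⟩

/-- A symbol of class `C ^ N` that lives at frequencies `|ξ| ≤ c * R` and varies at scale `R`. -/
structure IsLocalizedSymbol {E : Type*} [NormedAddCommGroup E] [NormedSpace ℝ E] (N : ℕ)
    (c R A : ℝ) (b : EuclideanSpace ℝ (Fin n) → E) : Prop where
  contDiff : ContDiff ℝ N b
  support_subset : Function.support b ⊆ Metric.closedBall 0 (c * R)
  norm_le : ∀ ξ, ‖b ξ‖ ≤ A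
  norm_iterate_partialD_le : ∀ i ξ, ‖(partialD i)^[N] b ξ‖ ≤ A * (R ^ N)⁻¹

namespace IsLocalizedSymbol

section Real

variable {E : Type*} [NormedAddCommGroup E] [NormedSpace ℝ E] {N : ℕ} {c R A : ℝ}
  {b : EuclideanSpace ℝ (Fin n) → E}

theorem tsupport_subset (hb : IsLocalizedSymbol N c R A b) :
    tsupport b ⊆ Metric.closedBall 0 (c * R) :=
  closure_minimal hb.support_subset Metric.isClosed_closedBall

theorem hasCompactSupport (hb : IsLocalizedSymbol N c R A b) : HasCompactSupport b :=
  (isCompact_closedBall _ _).of_isClosed_subset (isClosed_tsupport b) hb.tsupport_subset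

theorem clm_comp {E' : Type*} [NormedAddCommGroup E'] [NormedSpace ℝ E']
    (hb : IsLocalizedSymbol N c R A b) (L : E →L[ℝ] E') {C : ℝ} (hL : ‖L‖ ≤ C) :
    IsLocalizedSymbol N c R (C * A) fun ξ => L (b ξ) where
  contDiff := L.contDiff.comp hb.contDiff
  support_subset := (Function.support_comp_subset (map_zero L) b).trans hb.support_subset
  norm_le ξ := L.le_of_opNorm_le_of_le hL (hb.norm_le ξ)
  norm_iterate_partialD_le i ξ := by
    rw [mul_assoc]
    exact (norm_iterate_partialD_clm_comp_le L hb.contDiff i ξ).trans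
      (mul_le_mul hL (hb.norm_iterate_partialD_le i ξ) (norm_nonneg _) ((norm_nonneg L).trans hL))

end Real

variable {F : Type*} [NormedAddCommGroup F] [InnerProductSpace ℂ F] [CompleteSpace F] {N : ℕ}
  {c R A : ℝ} {b : EuclideanSpace ℝ (Fin n) → F}

theorem lintegral_coord_pow_mul_fourier_sq_le (hb : IsLocalizedSymbol N c R A b) (hR : 0 < R)
    (i : Fin n) : ∫⁻ z, ‖(R • z) i‖ₑ ^ (2 * N) * ‖𝓕 b z‖ₑ ^ 2 ≤
      ENNReal.ofReal A ^ 2 *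
        volume (Metric.closedBall (0 : EuclideanSpace ℝ (Fin n)) (c * R)) := by
  have hbc := hb.hasCompactSupport
  have hRN : 0 < R ^ N := pow_pos hR N
  calc ∫⁻ z, ‖(R • z) i‖ₑ ^ (2 * N) * ‖𝓕 b z‖ₑ ^ 2
      = ∫⁻ z, ENNReal.ofReal (R ^ N) ^ 2 * (‖z i‖ₑ ^ N * ‖𝓕 b z‖ₑ) ^ 2 := by
        congr 1 with z
        rw [PiLp.smul_apply, enorm_smul, Real.enorm_eq_ofReal hR.le, ENNReal.ofReal_pow hR.le]
        ring
    _ ≤ ∫⁻ z, ENNReal.ofReal (R ^ N) ^ 2 * ‖𝓕 ((partialD i)^[N] b) z‖ₑ ^ 2 := by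
        gcongr with z
        exact enorm_coord_pow_mul_fourier_le hb.contDiff hbc i z
    _ = ENNReal.ofReal (R ^ N) ^ 2 * eLpNorm ((partialD i)^[N] b) 2 volume ^ 2 := by
        rw [lintegral_const_mul' _ _ (by simp), lintegral_fourier_sq
          (continuous_iterate_partialD hb.contDiff i) (hasCompactSupport_iterate_partialD hbc i N)]
    _ ≤ ENNReal.ofReal (R ^ N) ^ 2 * (ENNReal.ofReal (A * (R ^ N)⁻¹) ^ 2 *
          volume (Metric.closedBall (0 : EuclideanSpace ℝ (Fin n)) (c * R))) := by
        gcongr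
        exact eLpNorm_two_sq_le_of_support Metric.isClosed_closedBall.measurableSet
          ((support_iterate_partialD_subset b i N).trans hb.tsupport_subset)
          (hb.norm_iterate_partialD_le i)
    _ = _ := by
        rw [← mul_assoc, ← mul_pow, ← ENNReal.ofReal_mul hRN.le, mul_left_comm,
          mul_inv_cancel₀ hRN.ne', mul_one]

theorem lintegral_kernelWeight_mul_fourier_sq_le (hb : IsLocalizedSymbol N c R A b)
    (hR : 0 < R) :
    ∫⁻ z, kernelWeight N (R • z) * ‖𝓕 b z‖ₑ ^ 2 ≤
      (n + 1) * (ENNReal.ofReal A ^ 2 * volume (Metric.closedBall (0 : EuclideanSpace ℝ (Fin n))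
        (c * R))) := by
  set Q := ENNReal.ofReal A ^ 2 *
    volume (Metric.closedBall (0 : EuclideanSpace ℝ (Fin n)) (c * R))
  have hbc := hb.hasCompactSupport
  have meas : Measurable fun z => ‖𝓕 b z‖ₑ ^ 2 := (continuous_fourier
    (hb.contDiff.continuous.integrable_of_hasCompactSupport hbc)).enorm.measurable.pow_const 2
  calc ∫⁻ z, kernelWeight N (R • z) * ‖𝓕 b z‖ₑ ^ 2
      = (∫⁻ z, ‖𝓕 b z‖ₑ ^ 2) + ∑ i, ∫⁻ z, ‖(R • z) i‖ₑ ^ (2 * N) * ‖𝓕 b z‖ₑ ^ 2 := by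
        simp only [kernelWeight, add_mul, one_mul, Finset.sum_mul]
        rw [lintegral_add_left meas, lintegral_finsetSum _ fun i _ => ?_]
        exact Measurable.mul (by fun_prop) meas
    _ ≤ Q + ∑ _i : Fin n, Q := by
        gcongr with i
        · rw [lintegral_fourier_sq hb.contDiff.continuous hbc]
          exact eLpNorm_two_sq_le_of_support Metric.isClosed_closedBall.measurableSet
            hb.support_subset hb.norm_le
        · exact hb.lintegral_coord_pow_mul_fourier_sq_le hR i
    _ = (n + 1) * Q := by simp [add_mul, add_comm]

end IsLocalizedSymbol

/-- The factor `R ^ n` from the volume of the frequency support cancels against the factor `R⁻¹ ^ n`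
from rescaling the inverse weight, so the bound does not depend on `R`. -/
theorem exists_eLpNorm_multOp_le (F G : Type*) [NormedAddCommGroup F] [InnerProductSpace ℂ F]
    [CompleteSpace F] [NormedAddCommGroup G] [InnerProductSpace ℂ G] [CompleteSpace G] {N : ℕ}
    (hN : n < 2 * N) {c : ℝ} (hc : 0 ≤ c) :
    ∃ K : ℝ≥0, ∀ (b : EuclideanSpace ℝ (Fin n) → EuclideanSpace ℝ (Fin n) → (F →L[ℂ] G))
      (A R : ℝ), 0 < R → (∀ x, IsLocalizedSymbol N c R A (b x)) →
      ∀ (f : 𝓢(EuclideanSpace ℝ (Fin n), F)) (u : EuclideanSpace ℝ (Fin n)),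
      eLpNorm (fun x => multOp (b x) f (x - u)) 2 volume ≤
        K * ENNReal.ofReal A * eLpNorm f 2 volume := by
  set v₁ := volume (Metric.ball (0 : EuclideanSpace ℝ (Fin n)) 1)
  set I : ℝ≥0∞ := ∫⁻ z : EuclideanSpace ℝ (Fin n), (kernelWeight N z)⁻¹
  set Q : ℝ≥0∞ := (n + 1) * (ENNReal.ofReal (c ^ n) * v₁) * I
  have hQt : Q ≠ ⊤ := ENNReal.mul_ne_top (ENNReal.mul_ne_top (by simp)
    (ENNReal.mul_ne_top (by simp) measure_ball_lt_top.ne)) (lintegral_inv_kernelWeight_lt_top hN).ne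
  obtain ⟨K, hK⟩ := exists_nnreal_le_sq hQt
  refine ⟨K, fun b A R hR hb f u => ?_⟩
  rw [← ENNReal.pow_le_pow_left_iff two_ne_zero]
  have scale_cancel : ENNReal.ofReal (R ^ n) * ENNReal.ofReal (R ^ n)⁻¹ = 1 := by
    rw [← ENNReal.ofReal_mul (by positivity), mul_inv_cancel₀ (by positivity), ENNReal.ofReal_one]
  calc eLpNorm (fun x => multOp (b x) f (x - u)) 2 volume ^ 2
      ≤ ((n + 1) * (ENNReal.ofReal A ^ 2 * volume (Metric.closedBall
          (0 : EuclideanSpace ℝ (Fin n)) (c * R)))) *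
          (∫⁻ z : EuclideanSpace ℝ (Fin n), (kernelWeight N (R • z))⁻¹) *
          eLpNorm f 2 volume ^ 2 := by
        refine eLpNorm_multOp_sq_le_of_kernel (w := fun z => kernelWeight N (R • z))
          (fun x => (hb x).contDiff.continuous) (fun x => (hb x).hasCompactSupport)
          ((measurable_kernelWeight N).comp (measurable_const_smul R))
          (fun z => kernelWeight_ne_zero N _) (fun z => kernelWeight_ne_top N _) (fun x v => ?_) f u
        refine (((hb x).clm_comp _
          (norm_adjointApply_le v)).lintegral_kernelWeight_mul_fourier_sq_le hR).trans_eq ?_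
        rw [ENNReal.ofReal_mul (norm_nonneg v), ofReal_norm]
        ring
    _ = Q * (ENNReal.ofReal (R ^ n) * ENNReal.ofReal (R ^ n)⁻¹) * ENNReal.ofReal A ^ 2 *
          eLpNorm f 2 volume ^ 2 := by
        rw [lintegral_comp_smul_of_pos volume (fun z => (kernelWeight N z)⁻¹) hR,
          Measure.addHaar_closedBall _ _ (by positivity), finrank_euclideanSpace_fin, mul_pow,
          ENNReal.ofReal_mul (pow_nonneg hc n)]
        ring
    _ ≤ (K : ℝ≥0∞) ^ 2 * 1 * ENNReal.ofReal A ^ 2 *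
          eLpNorm f 2 volume ^ 2 := by
        rw [scale_cancel]
        gcongr
    _ = _ := by ring

end KernelDecay

section Localization

open scoped ContDiff

variable {n : ℕ}

theorem one_le_bracket (ξ : EuclideanSpace ℝ (Fin n)) : 1 ≤ bracket ξ :=
  Real.one_le_sqrt.2 (by linarith [sq_nonneg ‖ξ‖])

theorem norm_le_bracket (ξ : EuclideanSpace ℝ (Fin n)) : ‖ξ‖ ≤ bracket ξ :=
  Real.le_sqrt_of_sq_le (by linarith)

/-- Symbol estimates of order zero for the pure derivatives `∂_i ^ k`, `k ≤ N`. The bound on `b`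
itself is a separate field because in dimension `0` there is no index `i`. -/
structure HasSymbolBound {E : Type*} [NormedAddCommGroup E] [NormedSpace ℝ E] (N : ℕ)
    (b : EuclideanSpace ℝ (Fin n) → E) (B : ℝ) : Prop where
  contDiff : ContDiff ℝ N b
  norm_le : ∀ ξ, ‖b ξ‖ ≤ B
  norm_partialD_le : ∀ i, ∀ k ≤ N, ∀ ξ, ‖(partialD i)^[k] b ξ‖ ≤ B * (bracket ξ ^ k)⁻¹

theorem exists_norm_iterate_partialD_le {E : Type*} [NormedAddCommGroup E] [NormedSpace ℝ E]
    {θ : EuclideanSpace ℝ (Fin n) → E} (hθ : ContDiff ℝ ∞ θ) (hc : HasCompactSupport θ) (N : ℕ) :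
    ∃ M : ℝ, 0 ≤ M ∧ (∀ ξ, ‖θ ξ‖ ≤ M) ∧ ∀ i, ∀ k ≤ N, ∀ ξ, ‖(partialD i)^[k] θ ξ‖ ≤ M := by
  obtain ⟨M₀, hM₀⟩ := hc.exists_bound_of_continuous hθ.continuous
  have bounded (p : Fin n × Fin (N + 1)) : ∃ M, ∀ ξ, ‖(partialD p.1)^[p.2] θ ξ‖ ≤ M :=
    (hasCompactSupport_iterate_partialD hc p.1 p.2).exists_bound_of_continuous
      (continuous_iterate_partialD (hθ.of_le (by exact_mod_cast le_top)) p.1)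
  choose M hM using bounded
  obtain ⟨M₁, hM₁⟩ := Finite.exists_le M
  refine ⟨max M₀ M₁, le_max_of_le_left ((norm_nonneg _).trans (hM₀ 0)),
    fun ξ => le_max_of_le_left (hM₀ ξ), fun i k hk ξ => le_max_of_le_right ?_⟩
  exact (hM (i, ⟨k, Nat.lt_succ_of_le hk⟩) ξ).trans (hM₁ _)

namespace HasSymbolBound

variable {E : Type*} [NormedAddCommGroup E] [NormedSpace ℝ E] {N : ℕ}
  {b : EuclideanSpace ℝ (Fin n) → E} {B : ℝ}

theorem nonneg (hb : HasSymbolBound N b B) : 0 ≤ B := (norm_nonneg _).trans (hb.norm_le 0)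

theorem norm_iterate_partialD_mul_le (hb : HasSymbolBound N b B)
    {θ : EuclideanSpace ℝ (Fin n) → ℝ} (hθ : ContDiff ℝ N θ) {M : ℝ}
    (hM : ∀ i, ∀ k ≤ N, ∀ ξ, ‖(partialD i)^[k] θ ξ‖ ≤ M) {R : ℝ} (hR : 0 < R)
    (hRθ : ∀ ξ ∈ tsupport θ, R ≤ bracket (R • ξ)) (i : Fin n) {l : ℕ} (hl : l ≤ N)
    (ξ : EuclideanSpace ℝ (Fin n)) :
    ‖(partialD i)^[l] (fun η => θ (R⁻¹ • η)) ξ‖ * ‖(partialD i)^[N - l] b ξ‖ ≤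
      M * B * (R ^ N)⁻¹ := by
  have hB := hb.nonneg
  have hM₀ : 0 ≤ M := (norm_nonneg _).trans (hM i l hl 0)
  rw [iterate_partialD_comp_smul (hθ.of_le (by exact_mod_cast hl)), norm_smul]
  by_cases h0 : (partialD i)^[l] θ (R⁻¹ • ξ) = 0
  · rw [h0, norm_zero, mul_zero, zero_mul]
    positivity
  have le_bracket : R ≤ bracket ξ := by
    simpa [smul_smul, hR.ne'] using hRθ _ (support_iterate_partialD_subset θ i l h0)
  calc ‖R⁻¹ ^ l‖ * ‖(partialD i)^[l] θ (R⁻¹ • ξ)‖ * ‖(partialD i)^[N - l] b ξ‖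
      ≤ (R ^ l)⁻¹ * M * (B * (R ^ (N - l))⁻¹) := by
        rw [norm_pow, norm_inv, Real.norm_of_nonneg hR.le, inv_pow]
        gcongr
        · exact hM i l hl _
        · exact (hb.norm_partialD_le i (N - l) (by omega) ξ).trans (by gcongr)
    _ = M * B * (R ^ l * R ^ (N - l))⁻¹ := by
        rw [mul_inv]
        ring
    _ = M * B * (R ^ N)⁻¹ := by rw [← pow_add, Nat.add_sub_cancel' hl]

theorem isLocalizedSymbol (hb : HasSymbolBound N b B) {θ : EuclideanSpace ℝ (Fin n) → ℝ}
    (hθ : ContDiff ℝ N θ) {c M : ℝ} (hc : Function.support θ ⊆ Metric.closedBall 0 c)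
    (hM₀ : ∀ ξ, ‖θ ξ‖ ≤ M) (hM : ∀ i, ∀ k ≤ N, ∀ ξ, ‖(partialD i)^[k] θ ξ‖ ≤ M) {R : ℝ}
    (hR : 0 < R) (hRθ : ∀ ξ ∈ tsupport θ, R ≤ bracket (R • ξ)) :
    IsLocalizedSymbol N c R (2 ^ N * M * B) fun ξ => θ (R⁻¹ • ξ) • b ξ where
  contDiff := (hθ.comp (contDiff_const_smul _)).smul hb.contDiff
  support_subset ξ hξ := by
    have h : θ (R⁻¹ • ξ) ≠ 0 := fun h => hξ (by simp [h])
    simpa [norm_smul, abs_of_pos hR, inv_mul_le_iff₀ hR, mul_comm] using hc h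
  norm_le ξ := by
    have hM' : 0 ≤ M := (norm_nonneg _).trans (hM₀ 0)
    have hB := hb.nonneg
    calc ‖θ (R⁻¹ • ξ) • b ξ‖ ≤ M * B := by
          rw [norm_smul]
          gcongr
          exacts [hM₀ _, hb.norm_le ξ]
      _ ≤ 2 ^ N * (M * B) := le_mul_of_one_le_left (by positivity) (one_le_pow₀ one_le_two)
      _ = 2 ^ N * M * B := by ring
  norm_iterate_partialD_le i ξ := by
    calc ‖(partialD i)^[N] (fun ξ => θ (R⁻¹ • ξ) • b ξ) ξ‖
        ≤ ∑ l ∈ Finset.range (N + 1), (N.choose l : ℝ) *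
            ‖(partialD i)^[l] (fun η => θ (R⁻¹ • η)) ξ‖ * ‖(partialD i)^[N - l] b ξ‖ :=
          norm_iterate_partialD_smul_le (hθ.comp (contDiff_const_smul _)) hb.contDiff i ξ
      _ ≤ ∑ l ∈ Finset.range (N + 1), (N.choose l : ℝ) * (M * B * (R ^ N)⁻¹) := by
          refine Finset.sum_le_sum fun l hl => ?_
          rw [mul_assoc]
          refine mul_le_mul_of_nonneg_left ?_ (Nat.cast_nonneg _)
          exact hb.norm_iterate_partialD_mul_le hθ hM hR hRθ i
            (Nat.lt_succ_iff.1 (Finset.mem_range.1 hl)) ξ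
      _ = 2 ^ N * M * B * (R ^ N)⁻¹ := by
          rw [← Finset.sum_mul, ← Nat.cast_sum, Nat.sum_range_choose]
          push_cast
          ring

end HasSymbolBound

theorem exists_eLpNorm_multOp_cutoff_le (F G : Type*) [NormedAddCommGroup F]
    [InnerProductSpace ℂ F] [CompleteSpace F] [NormedAddCommGroup G] [InnerProductSpace ℂ G]
    [CompleteSpace G] {N : ℕ} (hN : n < 2 * N) {θ : EuclideanSpace ℝ (Fin n) → ℝ}
    (hθ : ContDiff ℝ ∞ θ) (hθc : HasCompactSupport θ) :
    ∃ K : ℝ≥0, ∀ R : ℝ, 0 < R → (∀ ξ ∈ tsupport θ, R ≤ bracket (R • ξ)) →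
      ∀ (b : EuclideanSpace ℝ (Fin n) → EuclideanSpace ℝ (Fin n) → (F →L[ℂ] G)) (B : ℝ),
      (∀ x, HasSymbolBound N (b x) B) →
      ∀ (f : 𝓢(EuclideanSpace ℝ (Fin n), F)) (u : EuclideanSpace ℝ (Fin n)),
      eLpNorm (fun x => multOp (fun ξ => θ (R⁻¹ • ξ) • b x ξ) f (x - u)) 2 volume ≤
        K * ENNReal.ofReal B * eLpNorm f 2 volume := by
  obtain ⟨M, hM₀, hM, hM'⟩ := exists_norm_iterate_partialD_le hθ hθc N
  obtain ⟨c, hc, hθs⟩ := hθc.isCompact.isBounded.subset_closedBall_lt 0 0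
  obtain ⟨K, hK⟩ := exists_eLpNorm_multOp_le F G hN hc.le
  refine ⟨K * Real.toNNReal (2 ^ N * M), fun R hR hRθ b B hb f u => ?_⟩
  refine (hK _ _ R hR (fun x => (hb x).isLocalizedSymbol (hθ.of_le (by exact_mod_cast le_top))
    ((subset_tsupport θ).trans hθs) hM hM' hR hRθ) f u).trans_eq ?_
  rw [ENNReal.ofReal_mul (by positivity), ENNReal.coe_mul, ENNReal.ofReal]
  ring

end Localization

section Cutoffs

open scoped ContDiff

variable {V : Type*} [NormedAddCommGroup V] [InnerProductSpace ℝ V]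

section Bump

variable (V) in
/-- A smooth bump, equal to `1` on the unit ball and vanishing outside the ball of radius `2`. -/
noncomputable def freqBump : ContDiffBump (0 : V) := ⟨1, 2, one_pos, one_lt_two⟩

/-- A smooth cutoff to the frequencies `|ξ| ≲ 1`. -/
noncomputable def lowCut (ξ : V) : ℝ := freqBump V ξ

theorem lowCut_nonneg (ξ : V) : 0 ≤ lowCut ξ := (freqBump V).nonneg

theorem lowCut_le_one (ξ : V) : lowCut ξ ≤ 1 := (freqBump V).le_one

theorem lowCut_eq_one {ξ : V} (h : ‖ξ‖ ≤ 1) : lowCut ξ = 1 :=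
  (freqBump V).one_of_mem_closedBall (mem_closedBall_zero_iff.2 h)

theorem lowCut_eq_zero {ξ : V} (h : 2 ≤ ‖ξ‖) : lowCut ξ = 0 :=
  (freqBump V).zero_of_le_dist (by rwa [dist_zero_right])

theorem lowCut_smul_anti {s t : ℝ} (hs : 0 ≤ s) (hst : 2 * s ≤ t) (ξ : V) :
    lowCut (t • ξ) ≤ lowCut (s • ξ) := by
  rcases le_total (s * ‖ξ‖) 1 with h | h
  · rw [lowCut_eq_one (ξ := s • ξ) (by rwa [norm_smul, Real.norm_of_nonneg hs])]
    exact lowCut_le_one _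
  · rw [lowCut_eq_zero (ξ := t • ξ)]
    · exact lowCut_nonneg _
    · rw [norm_smul, Real.norm_of_nonneg (by linarith)]
      nlinarith [norm_nonneg ξ]

/-- A smooth cutoff to the frequencies `|ξ| ∼ 1`. The dilates `bandCut (4⁻ʲ ξ)`, `j ≥ 0`, and
`lowCut ξ` form a partition of unity. -/
noncomputable def bandCut (ξ : V) : ℝ := lowCut ((4 : ℝ)⁻¹ • ξ) - lowCut ξ

/-- A wider cutoff to the frequencies `|ξ| ∼ 1`, equal to `1` on the support of `bandCut`. -/
noncomputable def wideCut (ξ : V) : ℝ := lowCut ((16 : ℝ)⁻¹ • ξ) - lowCut ((4 : ℝ) • ξ)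

theorem one_le_norm_of_bandCut_ne_zero {ξ : V} (h : bandCut ξ ≠ 0) : 1 ≤ ‖ξ‖ := by
  contrapose! h
  rw [bandCut, lowCut_eq_one, lowCut_eq_one h.le, sub_self]
  rw [norm_smul, norm_inv, Real.norm_ofNat]
  linarith

theorem norm_le_of_bandCut_ne_zero {ξ : V} (h : bandCut ξ ≠ 0) : ‖ξ‖ ≤ 8 := by
  contrapose! h
  rw [bandCut, lowCut_eq_zero, lowCut_eq_zero (by linarith), sub_self]
  rw [norm_smul, norm_inv, Real.norm_ofNat]
  linarith

theorem one_le_norm_of_mem_tsupport_bandCut {ξ : V} (h : ξ ∈ tsupport (bandCut (V := V))) :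
    1 ≤ ‖ξ‖ := by
  have hc : IsClosed {ξ : V | 1 ≤ ‖ξ‖} := isClosed_le continuous_const continuous_norm
  exact closure_minimal (fun _ hη => one_le_norm_of_bandCut_ne_zero hη) hc h

theorem wideCut_mul_bandCut (ξ : V) : wideCut ξ * bandCut ξ = bandCut ξ := by
  rcases eq_or_ne (bandCut ξ) 0 with h | h
  · rw [h, mul_zero]
  have hle := one_le_norm_of_bandCut_ne_zero h
  have hge := norm_le_of_bandCut_ne_zero h
  rw [wideCut, lowCut_eq_one, lowCut_eq_zero, sub_zero, one_mul]
  · rw [norm_smul, Real.norm_ofNat]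
    linarith
  · rw [norm_smul, norm_inv, Real.norm_ofNat]
    linarith

theorem wideCut_nonneg (ξ : V) : 0 ≤ wideCut ξ :=
  sub_nonneg.2 (lowCut_smul_anti (by norm_num) (by norm_num) ξ)

theorem wideCut_le_one (ξ : V) : wideCut ξ ≤ 1 :=
  (sub_le_self _ (lowCut_nonneg _)).trans (lowCut_le_one _)

theorem norm_lowCut_le_one (ξ : V) : ‖lowCut ξ‖ ≤ 1 := by
  rw [Real.norm_of_nonneg (lowCut_nonneg ξ)]
  exact lowCut_le_one ξ

theorem norm_bandCut_le_one (ξ : V) : ‖bandCut ξ‖ ≤ 1 :=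
  abs_sub_le_of_nonneg_of_le (lowCut_nonneg _) (lowCut_le_one _) (lowCut_nonneg _)
    (lowCut_le_one _)

theorem lowCut_inv_pow_succ (j : ℕ) (ξ : V) :
    lowCut (((4 : ℝ) ^ (j + 1))⁻¹ • ξ) =
      lowCut (((4 : ℝ) ^ j)⁻¹ • ξ) + bandCut (((4 : ℝ) ^ j)⁻¹ • ξ) := by
  rw [bandCut, add_sub_cancel, smul_smul, pow_succ', mul_inv]

theorem sum_wideCut_sq_le (J : ℕ) (ξ : V) :
    ∑ j ∈ Finset.range J, wideCut (((4 : ℝ) ^ j)⁻¹ • ξ) ^ 2 ≤ 3 := by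
  let a (j : ℕ) : ℝ := lowCut (((4 : ℝ) ^ j)⁻¹ • (4 : ℝ) • ξ)
  have ha₀ (j) : 0 ≤ a j := lowCut_nonneg _
  have ha₁ (j) : a j ≤ 1 := lowCut_le_one _
  have wide_eq (j) : wideCut (((4 : ℝ) ^ j)⁻¹ • ξ) = a (j + 3) - a j := by
    simp only [wideCut, a, smul_smul]
    congr 3
    · rw [pow_add, mul_inv]
      norm_num
      ring
    · rw [mul_comm]
  have telescope (J : ℕ) : ∑ j ∈ Finset.range J, (a (j + 3) - a j) =
      (a J + a (J + 1) + a (J + 2)) - (a 0 + a 1 + a 2) := by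
    induction J with
    | zero => simp
    | succ J ih =>
      rw [Finset.sum_range_succ, ih]
      ring
  calc ∑ j ∈ Finset.range J, wideCut (((4 : ℝ) ^ j)⁻¹ • ξ) ^ 2
      ≤ ∑ j ∈ Finset.range J, wideCut (((4 : ℝ) ^ j)⁻¹ • ξ) :=
        Finset.sum_le_sum fun j _ => pow_le_of_le_one (wideCut_nonneg _) (wideCut_le_one _)
          two_ne_zero
    _ ≤ 3 := by
        simp only [wide_eq, telescope]
        linarith [ha₁ J, ha₁ (J + 1), ha₁ (J + 2), ha₀ 0, ha₀ 1, ha₀ 2]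

theorem tendsto_lowCut (ξ : V) :
    Filter.Tendsto (fun J : ℕ => lowCut (((4 : ℝ) ^ J)⁻¹ • ξ)) Filter.atTop (nhds 1) := by
  refine tendsto_const_nhds.congr' ?_
  have h := tendsto_pow_atTop_atTop_of_one_lt (show (1 : ℝ) < 4 by norm_num)
  filter_upwards [h.eventually_ge_atTop ‖ξ‖] with J hJ
  rw [lowCut_eq_one]
  rwa [norm_smul, norm_inv, norm_pow, Real.norm_ofNat, inv_mul_le_iff₀ (by positivity), mul_one]

end Bump

variable [FiniteDimensional ℝ V]

theorem contDiff_lowCut : ContDiff ℝ ∞ (lowCut (V := V)) := (freqBump V).contDiff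

theorem contDiff_bandCut : ContDiff ℝ ∞ (bandCut (V := V)) :=
  (contDiff_lowCut.comp (contDiff_const_smul _)).sub contDiff_lowCut

theorem contDiff_wideCut : ContDiff ℝ ∞ (wideCut (V := V)) :=
  (contDiff_lowCut.comp (contDiff_const_smul _)).sub
    (contDiff_lowCut.comp (contDiff_const_smul _))

theorem hasCompactSupport_lowCut : HasCompactSupport (lowCut (V := V)) :=
  (freqBump V).hasCompactSupport

theorem hasCompactSupport_bandCut : HasCompactSupport (bandCut (V := V)) :=
  (hasCompactSupport_lowCut.comp_smul (by norm_num)).sub hasCompactSupport_lowCut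

theorem hasCompactSupport_wideCut : HasCompactSupport (wideCut (V := V)) :=
  (hasCompactSupport_lowCut.comp_smul (by norm_num)).sub
    (hasCompactSupport_lowCut.comp_smul (by norm_num))

end Cutoffs

section FrequencyProjection

open SchwartzMap (fourierMultiplierCLM)

variable {V F G : Type*} [NormedAddCommGroup V] [InnerProductSpace ℝ V] [FiniteDimensional ℝ V]
  [MeasurableSpace V] [BorelSpace V] [NormedAddCommGroup F] [InnerProductSpace ℂ F]
  [CompleteSpace F] [NormedAddCommGroup G] [InnerProductSpace ℂ G]

theorem fourier_fourierMultiplierCLM (θ : 𝓢(V, ℂ)) (f : 𝓢(V, F)) (ξ : V) :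
    𝓕 (fourierMultiplierCLM F θ f : V → F) ξ = θ ξ • 𝓕 (f : V → F) ξ := by
  rw [← SchwartzMap.fourier_coe, SchwartzMap.fourierMultiplierCLM_apply,
    FourierTransform.fourier_fourierInv_eq,
    SchwartzMap.smulLeftCLM_apply_apply θ.hasTemperateGrowth, SchwartzMap.fourier_coe]

theorem multOp_fourierMultiplierCLM {θ : 𝓢(V, ℂ)} {b : V → (F →L[ℂ] G)}
    (h : ∀ ξ, θ ξ • b ξ = b ξ) (f : 𝓢(V, F)) :
    multOp b (fourierMultiplierCLM F θ f) = multOp b f := by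
  unfold multOp
  congr 1 with ξ
  rw [fourier_fourierMultiplierCLM, map_smul, ← smul_apply, h]

theorem sum_eLpNorm_fourierMultiplierCLM_sq_le {ι : Type*} (s : Finset ι) {θ : ι → 𝓢(V, ℂ)}
    {C : ℝ≥0∞} (hC : ∀ ξ, ∑ i ∈ s, ‖θ i ξ‖ₑ ^ 2 ≤ C ^ 2) (f : 𝓢(V, F)) :
    ∑ i ∈ s, eLpNorm (fourierMultiplierCLM F (θ i) f) 2 volume ^ 2 ≤
      (C * eLpNorm f 2 volume) ^ 2 := by
  have hf : Measurable fun ξ => ‖𝓕 (f : V → F) ξ‖ₑ ^ 2 :=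
    (continuous_fourier f.integrable).enorm.measurable.pow_const 2
  have hθ (i) : Measurable fun ξ => ‖θ i ξ‖ₑ ^ 2 := (θ i).continuous.enorm.measurable.pow_const 2
  calc ∑ i ∈ s, eLpNorm (fourierMultiplierCLM F (θ i) f) 2 volume ^ 2
      = ∑ i ∈ s, ∫⁻ ξ, ‖θ i ξ‖ₑ ^ 2 * ‖𝓕 (f : V → F) ξ‖ₑ ^ 2 := by
        refine Finset.sum_congr rfl fun i _ => ?_
        rw [← eLpNorm_fourier (SchwartzMap.integrable _) (SchwartzMap.memLp _ 2 volume),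
          eLpNorm_two_sq]
        simp only [fourier_fourierMultiplierCLM, enorm_smul, mul_pow]
    _ = ∫⁻ ξ, (∑ i ∈ s, ‖θ i ξ‖ₑ ^ 2) * ‖𝓕 (f : V → F) ξ‖ₑ ^ 2 := by
        simp only [Finset.sum_mul]
        exact (lintegral_finsetSum _ fun i _ => (hθ i).mul hf).symm
    _ ≤ ∫⁻ ξ, C ^ 2 * ‖𝓕 (f : V → F) ξ‖ₑ ^ 2 := lintegral_mono fun ξ => by
        gcongr
        exact hC ξ
    _ = (C * eLpNorm f 2 volume) ^ 2 := by
        rw [lintegral_const_mul _ hf, ← eLpNorm_two_sq,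
          eLpNorm_fourier f.integrable (f.memLp 2), mul_pow]

theorem fourierMultiplierCLM_apply_eq_integral (θ : 𝓢(V, ℂ)) (g : 𝓢(V, F)) (x : V) :
    fourierMultiplierCLM F θ g x = ∫ u, 𝓕 (θ : V → ℂ) u • g (u + x) := by
  rw [integral_fourier_smul θ.integrable (g.integrable.comp_add_right x),
    SchwartzMap.fourierMultiplierCLM_apply, SchwartzMap.fourierInv_coe, Real.fourierInv_eq]
  congr 1 with ξ
  rw [fourier_comp_add_right, SchwartzMap.smulLeftCLM_apply_apply θ.hasTemperateGrowth, smul_comm,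
    SchwartzMap.fourier_coe]

theorem conj_fourierInv {θ : V → ℂ} (hθ : ∀ ξ, starRingEnd ℂ (θ ξ) = θ ξ) (u : V) :
    starRingEnd ℂ (𝓕⁻ θ u) = 𝓕 θ u := by
  rw [Real.fourierInv_eq, Real.fourier_eq, ← integral_conj]
  congr 1 with ξ
  rw [Circle.smul_def, Circle.smul_def, smul_eq_mul, smul_eq_mul, map_mul, hθ,
    AddChar.map_neg_eq_inv, Circle.coe_inv_eq_conj]

theorem integral_fourierInv_smul_fourierInv (θ : 𝓢(V, ℂ)) {h : V → F} (hh : Integrable h)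
    (x : V) : ∫ u, 𝓕⁻ (θ : V → ℂ) u • 𝓕⁻ h (x - u) = 𝓕⁻ (fun ξ => θ ξ • h ξ) x := by
  have hhx : Integrable fun ξ => Real.fourierChar (inner ℝ ξ x) • h ξ := by
    simpa using (Real.fourierIntegral_convergent_iff (f := h) (-x)).2 hh
  have fourier_hx (u : V) :
      𝓕 (fun ξ => Real.fourierChar (inner ℝ ξ x) • h ξ) u = 𝓕⁻ h (x - u) := by
    rw [Real.fourier_eq, Real.fourierInv_eq]
    congr 1 with ξ
    rw [smul_smul, ← AddChar.map_add_eq_mul, inner_sub_right, neg_add_eq_sub]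
  have fourier_kernel : 𝓕 (𝓕⁻ (θ : V → ℂ)) = θ := by
    rw [← SchwartzMap.fourierInv_coe, ← SchwartzMap.fourier_coe,
      FourierTransform.fourier_fourierInv_eq]
  have hθ : Integrable (𝓕⁻ (θ : V → ℂ)) := by
    rw [← SchwartzMap.fourierInv_coe]
    exact SchwartzMap.integrable _
  calc ∫ u, 𝓕⁻ (θ : V → ℂ) u • 𝓕⁻ h (x - u)
      = ∫ ξ, 𝓕 (𝓕⁻ (θ : V → ℂ)) ξ • Real.fourierChar (inner ℝ ξ x) • h ξ := by
        rw [integral_fourier_smul hθ hhx]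
        simp only [fourier_hx]
    _ = 𝓕⁻ (fun ξ => θ ξ • h ξ) x := by
        rw [fourier_kernel, Real.fourierInv_eq]
        simp only [smul_comm (θ _)]

theorem fourierInv_comp_inv_smul (θ : V → ℂ) {R : ℝ} (hR : 0 < R) (u : V) :
    𝓕⁻ (fun ξ => θ (R⁻¹ • ξ)) u = R ^ Module.finrank ℝ V • 𝓕⁻ θ (R • u) := by
  rw [Real.fourierInv_eq, Real.fourierInv_eq, ← Measure.integral_comp_inv_smul_of_nonneg _ _ hR.le]
  congr 1 with ξ
  rw [inner_smul_left, inner_smul_right, conj_trivial, inv_mul_cancel_left₀ hR.ne']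

theorem lintegral_fourierInv_comp_inv_smul (θ : V → ℂ) (w : V → ℝ≥0∞) {R : ℝ} (hR : 0 < R) :
    ∫⁻ u, ‖𝓕⁻ (fun ξ => θ (R⁻¹ • ξ)) u‖ₑ * w (R • u) = ∫⁻ u, ‖𝓕⁻ θ u‖ₑ * w u := by
  have hRd : 0 < R ^ Module.finrank ℝ V := by positivity
  simp only [fourierInv_comp_inv_smul θ hR, enorm_smul, mul_assoc]
  rw [lintegral_const_mul' _ _ enorm_ne_top,
    lintegral_comp_smul_of_pos volume (fun u => ‖𝓕⁻ θ u‖ₑ * w u) hR,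
    Real.enorm_of_nonneg hRd.le, ← mul_assoc, ← ENNReal.ofReal_mul hRd.le,
    mul_inv_cancel₀ hRd.ne', ENNReal.ofReal_one, one_mul]

theorem lintegral_enorm_mul_one_add_norm_lt_top {E : Type*} [NormedAddCommGroup E]
    [NormedSpace ℝ E] (κ : 𝓢(V, E)) :
    ∫⁻ u, ‖κ u‖ₑ * ENNReal.ofReal (1 + ‖u‖) < ⊤ := by
  have h := κ.integrable.norm.add (κ.integrable_pow_mul volume 1)
  refine (lintegral_congr fun u => ?_).trans_lt h.2
  rw [← ofReal_norm, ← ofReal_norm, ← ENNReal.ofReal_mul (norm_nonneg _), Pi.add_apply, pow_one,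
    Real.norm_of_nonneg (by positivity)]
  congr 1
  ring

end FrequencyProjection

section WideProjection

variable (V : Type*) [NormedAddCommGroup V] [InnerProductSpace ℝ V] [FiniteDimensional ℝ V]

/-- The dilate of `wideCut` to the frequencies `|ξ| ∼ 4 ^ j`, as a symbol to which
`SchwartzMap.fourierMultiplierCLM` applies. -/
noncomputable def wideSymbol (j : ℕ) : 𝓢(V, ℂ) :=
  HasCompactSupport.toSchwartzMap (f := fun ξ => (wideCut (((4 : ℝ) ^ j)⁻¹ • ξ) : ℂ))
    ((hasCompactSupport_wideCut.comp_smul (by positivity)).comp_left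
      (g := fun r : ℝ => (r : ℂ)) Complex.ofReal_zero)
    (Complex.ofRealCLM.contDiff.comp (contDiff_wideCut.comp (contDiff_const_smul _)))

variable {V}

theorem wideSymbol_apply (j : ℕ) (ξ : V) :
    wideSymbol V j ξ = wideCut (((4 : ℝ) ^ j)⁻¹ • ξ) := rfl

theorem conj_wideSymbol (j : ℕ) (ξ : V) : starRingEnd ℂ (wideSymbol V j ξ) = wideSymbol V j ξ :=
  Complex.conj_ofReal _

variable [MeasurableSpace V] [BorelSpace V]

/-- The smooth Littlewood–Paley projection to the frequencies `|ξ| ∼ 4 ^ j`. -/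
noncomputable def wideProj {F : Type*} [NormedAddCommGroup F] [NormedSpace ℂ F] (j : ℕ) :
    𝓢(V, F) →L[ℂ] 𝓢(V, F) :=
  SchwartzMap.fourierMultiplierCLM F (wideSymbol V j)

theorem sum_eLpNorm_wideProj_sq_le {F : Type*} [NormedAddCommGroup F] [InnerProductSpace ℂ F]
    [CompleteSpace F] (J : ℕ) (f : 𝓢(V, F)) :
    ∑ j ∈ Finset.range J, eLpNorm (wideProj j f) 2 volume ^ 2 ≤ (2 * eLpNorm f 2 volume) ^ 2 := by
  refine sum_eLpNorm_fourierMultiplierCLM_sq_le _ (fun ξ => ?_) f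
  calc ∑ j ∈ Finset.range J, ‖wideSymbol V j ξ‖ₑ ^ 2
      = ENNReal.ofReal (∑ j ∈ Finset.range J, wideCut (((4 : ℝ) ^ j)⁻¹ • ξ) ^ 2) := by
        rw [ENNReal.ofReal_sum_of_nonneg fun j _ => sq_nonneg _]
        refine Finset.sum_congr rfl fun j _ => ?_
        rw [wideSymbol_apply, ← ofReal_norm, Complex.norm_real,
          Real.norm_of_nonneg (wideCut_nonneg _), ENNReal.ofReal_pow (wideCut_nonneg _)]
    _ ≤ ENNReal.ofReal (2 ^ 2) :=
        ENNReal.ofReal_le_ofReal ((sum_wideCut_sq_le J ξ).trans (by norm_num))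
    _ = 2 ^ 2 := by norm_num

theorem exists_lintegral_wideKernel_le :
    ∃ c : ℝ≥0, ∀ j, ∫⁻ u, ‖𝓕⁻ (wideSymbol V j : V → ℂ) u‖ₑ *
      ENNReal.ofReal (1 + 4 ^ j * ‖u‖) ≤ c := by
  refine ⟨(∫⁻ u, ‖(𝓕⁻ (wideSymbol V 0)) u‖ₑ * ENNReal.ofReal (1 + ‖u‖)).toNNReal,
    fun j => le_of_eq ?_⟩
  have dilate : (wideSymbol V j : V → ℂ) = fun ξ => wideSymbol V 0 (((4 : ℝ) ^ j)⁻¹ • ξ) := by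
    ext ξ
    simp [wideSymbol_apply]
  rw [ENNReal.coe_toNNReal (lintegral_enorm_mul_one_add_norm_lt_top _).ne,
    SchwartzMap.fourierInv_coe, ← lintegral_fourierInv_comp_inv_smul (wideSymbol V 0 : V → ℂ) _
      (show (0 : ℝ) < 4 ^ j by positivity), dilate]
  simp only [norm_smul, norm_pow, Real.norm_ofNat]

end WideProjection

section BoundedSymbol

variable {V F G : Type*} [NormedAddCommGroup V] [NormedAddCommGroup F] [InnerProductSpace ℂ F]
  [NormedAddCommGroup G] [InnerProductSpace ℂ G]

/-- A bounded symbol `a(x, ξ)`, separately continuous in `x` and `ξ`. This is what makes the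
pseudo-differential operator `x ↦ multOp (a x) f x` well defined, bounded and continuous for
Schwartz `f`. -/
structure IsBoundedSymbol (a : V → V → (F →L[ℂ] G)) (A : ℝ) : Prop where
  continuous_left : ∀ ξ, Continuous fun x => a x ξ
  continuous_right : ∀ x, Continuous (a x)
  norm_le : ∀ x ξ, ‖a x ξ‖ ≤ A

namespace IsBoundedSymbol

variable {a : V → V → (F →L[ℂ] G)} {A : ℝ}

theorem smul (ha : IsBoundedSymbol a A) {θ : V → ℝ} (hθ : Continuous θ) {C : ℝ}
    (hC : ∀ ξ, ‖θ ξ‖ ≤ C) : IsBoundedSymbol (fun x ξ => θ ξ • a x ξ) (C * A) where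
  continuous_left ξ := (ha.continuous_left ξ).const_smul (θ ξ)
  continuous_right x := hθ.smul (ha.continuous_right x)
  norm_le x ξ := by
    rw [norm_smul]
    exact mul_le_mul (hC ξ) (ha.norm_le x ξ) (norm_nonneg _) ((norm_nonneg _).trans (hC ξ))

variable [InnerProductSpace ℝ V] [FiniteDimensional ℝ V] [MeasurableSpace V] [BorelSpace V]

theorem norm_apply_fourier_le (ha : IsBoundedSymbol a A) (f : V → F) (x ξ : V) :
    ‖a x ξ (𝓕 f ξ)‖ ≤ A * ‖𝓕 f ξ‖ :=
  (a x ξ).le_of_opNorm_le (ha.norm_le x ξ) _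

theorem integrable_apply_fourier (ha : IsBoundedSymbol a A) (f : 𝓢(V, F)) (x : V) :
    Integrable fun ξ => a x ξ (𝓕 (f : V → F) ξ) :=
  ((𝓕 f).integrable.norm.const_mul A).mono'
    ((ha.continuous_right x).clm_apply (continuous_fourier f.integrable)).aestronglyMeasurable
    (Filter.Eventually.of_forall fun ξ => ha.norm_apply_fourier_le f x ξ)

theorem norm_multOp_le (ha : IsBoundedSymbol a A) (f : 𝓢(V, F)) (x y : V) :
    ‖multOp (a x) f y‖ ≤ A * ∫ ξ, ‖𝓕 f ξ‖ := by
  rw [multOp_apply, ← integral_const_mul]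
  refine norm_integral_le_of_norm_le ((𝓕 f).integrable.norm.const_mul A)
    (Filter.Eventually.of_forall fun ξ => ?_)
  rw [Circle.norm_smul]
  exact ha.norm_apply_fourier_le f x ξ

theorem integrable_fourierChar_smul (ha : IsBoundedSymbol a A) (f : 𝓢(V, F)) (x y : V) :
    Integrable fun ξ => Real.fourierChar (inner ℝ ξ y) • a x ξ (𝓕 (f : V → F) ξ) := by
  simpa using (Real.fourierIntegral_convergent_iff (-y)).2 (ha.integrable_apply_fourier f x)

theorem multOp_sub (ha : IsBoundedSymbol a A) (f : 𝓢(V, F)) (x x' y : V) :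
    multOp (fun ξ => a x ξ - a x' ξ) f y = multOp (a x) f y - multOp (a x') f y := by
  simp only [multOp_apply, sub_apply, smul_sub,
    integral_sub (ha.integrable_fourierChar_smul f x y) (ha.integrable_fourierChar_smul f x' y)]

theorem continuous_multOp {X : Type*} [TopologicalSpace X] [FirstCountableTopology X]
    (ha : IsBoundedSymbol a A) (f : 𝓢(V, F)) {φ ψ : X → V} (hφ : Continuous φ)
    (hψ : Continuous ψ) : Continuous fun p => multOp (a (φ p)) f (ψ p) := by
  have hchar : Continuous fun q : X × V => Real.fourierChar (inner ℝ q.2 (ψ q.1)) :=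
    Real.continuous_fourierChar.comp (by fun_prop)
  simp only [multOp_apply]
  refine continuous_of_dominated (bound := fun ξ => A * ‖𝓕 f ξ‖) (fun p => ?_)
    (fun p => Filter.Eventually.of_forall fun ξ => ?_) ((𝓕 f).integrable.norm.const_mul A)
    (Filter.Eventually.of_forall fun ξ => ?_)
  · exact ((hchar.comp (Continuous.prodMk_right p)).smul ((ha.continuous_right (φ p)).clm_apply
      (continuous_fourier f.integrable))).aestronglyMeasurable
  · rw [Circle.norm_smul]
    exact ha.norm_apply_fourier_le f (φ p) ξ
  · exact (hchar.comp (Continuous.prodMk_left ξ)).smul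
      (((ha.continuous_left ξ).comp hφ).clm_apply continuous_const)

end IsBoundedSymbol

end BoundedSymbol

section Commutator

variable {V F G : Type*} [NormedAddCommGroup V] [InnerProductSpace ℝ V] [FiniteDimensional ℝ V]
  [MeasurableSpace V] [BorelSpace V] [NormedAddCommGroup F] [InnerProductSpace ℂ F]
  [NormedAddCommGroup G] [InnerProductSpace ℂ G]

theorem integrable_inner_kernel_smul {κ : V → ℂ} (hκ : Integrable κ) {Φ : V × V → G}
    (hΦ : Continuous Φ) {M : ℝ} (hM : ∀ p, ‖Φ p‖ ≤ M) {g : V → G} (hg : Integrable g) :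
    Integrable (fun p : V × V => ⟪κ p.2 • Φ p, g p.1⟫_ℂ) (volume.prod volume) := by
  refine ((hg.norm.mul_prod hκ.norm).const_mul M).mono'
    ((hκ.1.comp_snd.smul hΦ.aestronglyMeasurable).inner hg.1.comp_fst)
    (Filter.Eventually.of_forall fun p => ?_)
  calc ‖⟪κ p.2 • Φ p, g p.1⟫_ℂ‖ ≤ ‖κ p.2‖ * ‖Φ p‖ * ‖g p.1‖ :=
        (norm_inner_le_norm _ _).trans_eq (by rw [norm_smul])
    _ ≤ ‖κ p.2‖ * M * ‖g p.1‖ := by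
        gcongr
        exact hM p
    _ = M * (‖g p.1‖ * ‖κ p.2‖) := by ring

variable [CompleteSpace G]

theorem integral_inner_convolution {κ : V → ℂ} (hκ : Integrable κ) {Φ : V → G}
    (hΦ : Continuous Φ) {M : ℝ} (hM : ∀ x, ‖Φ x‖ ≤ M) (g : 𝓢(V, G)) :
    ∫ x, ⟪Φ x, ∫ u, starRingEnd ℂ (κ u) • g (u + x)⟫_ℂ =
      ∫ u, ∫ x, ⟪κ u • Φ (x - u), g x⟫_ℂ := by
  have hint (x : V) : Integrable fun u => starRingEnd ℂ (κ u) • g (u + x) := by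
    refine (hκ.norm.mul_const (SchwartzMap.seminorm ℝ 0 0 g)).mono'
      ((Complex.continuous_conj.comp_aestronglyMeasurable hκ.1).smul (by fun_prop))
      (Filter.Eventually.of_forall fun u => ?_)
    rw [norm_smul, RCLike.norm_conj]
    exact mul_le_mul_of_nonneg_left (g.norm_le_seminorm ℝ _) (norm_nonneg _)
  have hprod : Integrable (fun p : V × V => ⟪κ p.2 • Φ p.1, g (p.1 + p.2)⟫_ℂ)
      (volume.prod volume) := by
    have h := (measurePreserving_add_prod (volume : Measure V)
      (volume : Measure V)).integrable_comp_of_integrable (integrable_inner_kernel_smul hκ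
        (hΦ.comp (continuous_fst.sub continuous_snd)) (fun p => hM _) g.integrable)
    simpa only [Function.comp_def, Pi.sub_apply, add_sub_cancel_right] using h
  calc ∫ x, ⟪Φ x, ∫ u, starRingEnd ℂ (κ u) • g (u + x)⟫_ℂ
      = ∫ x, ∫ u, ⟪κ u • Φ x, g (x + u)⟫_ℂ := by
        congr 1 with x
        rw [← integral_inner (hint x)]
        simp only [inner_smul_left, inner_smul_right, add_comm x]
    _ = ∫ u, ∫ x, ⟪κ u • Φ x, g (x + u)⟫_ℂ := integral_integral_swap hprod
    _ = ∫ u, ∫ x, ⟪κ u • Φ (x - u), g x⟫_ℂ := by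
        congr 1 with u
        rw [← integral_add_right_eq_self (fun x => ⟪κ u • Φ (x - u), g x⟫_ℂ) u]
        simp only [add_sub_cancel_right]

namespace IsBoundedSymbol

open SchwartzMap (fourierMultiplierCLM)

variable {a : V → V → (F →L[ℂ] G)} {A : ℝ}

theorem inner_multOp_eq_integral (ha : IsBoundedSymbol a A) {θ : 𝓢(V, ℂ)}
    (haθ : ∀ x ξ, θ ξ • a x ξ = a x ξ) (f : 𝓢(V, F)) (x : V) (v : G) :
    ⟪multOp (a x) f x, v⟫_ℂ = ∫ u, ⟪𝓕⁻ (θ : V → ℂ) u • multOp (a x) f (x - u), v⟫_ℂ := by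
  have hint : Integrable fun u => 𝓕⁻ (θ : V → ℂ) u • multOp (a x) f (x - u) := by
    refine ((𝓕⁻ θ).integrable.norm.mul_const (A * ∫ ξ, ‖𝓕 f ξ‖)).mono' ?_ ?_
    · rw [← SchwartzMap.fourierInv_coe]
      exact ((𝓕⁻ θ).continuous.smul (ha.continuous_multOp f continuous_const
        (continuous_const.sub continuous_id))).aestronglyMeasurable
    · refine Filter.Eventually.of_forall fun u => ?_
      rw [norm_smul, SchwartzMap.fourierInv_coe]
      exact mul_le_mul_of_nonneg_left (ha.norm_multOp_le f x _) (norm_nonneg _)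
  rw [integral_inner_left hint]
  congr 1
  rw [multOp, integral_fourierInv_smul_fourierInv θ (ha.integrable_apply_fourier f x)]
  simp only [← smul_apply, haθ]

theorem integral_inner_sub_fourierMultiplierCLM (ha : IsBoundedSymbol a A) {θ : 𝓢(V, ℂ)}
    (hθ : ∀ ξ, starRingEnd ℂ (θ ξ) = θ ξ) (haθ : ∀ x ξ, θ ξ • a x ξ = a x ξ) (f : 𝓢(V, F))
    (g : 𝓢(V, G)) :
    (∫ x, ⟪multOp (a x) f x, g x⟫_ℂ) - ∫ x, ⟪multOp (a x) f x, fourierMultiplierCLM G θ g x⟫_ℂ =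
      ∫ u, ∫ x, ⟪𝓕⁻ (θ : V → ℂ) u • multOp (fun ξ => a x ξ - a (x - u) ξ) f (x - u), g x⟫_ℂ := by
  set κ := 𝓕⁻ (θ : V → ℂ) with hκ_def
  have hκ : Integrable κ := by
    rw [hκ_def, ← SchwartzMap.fourierInv_coe]
    exact (𝓕⁻ θ).integrable
  have hcont : Continuous fun x => multOp (a x) f x :=
    ha.continuous_multOp f continuous_id continuous_id
  have hfst : Integrable (fun p : V × V => ⟪κ p.2 • multOp (a p.1) f (p.1 - p.2), g p.1⟫_ℂ)
      (volume.prod volume) :=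
    integrable_inner_kernel_smul hκ
      (ha.continuous_multOp f continuous_fst (continuous_fst.sub continuous_snd))
      (fun p => ha.norm_multOp_le f _ _) g.integrable
  have hsnd : Integrable (fun p : V × V => ⟪κ p.2 • multOp (a (p.1 - p.2)) f (p.1 - p.2), g p.1⟫_ℂ)
      (volume.prod volume) :=
    integrable_inner_kernel_smul hκ (hcont.comp (continuous_fst.sub continuous_snd))
      (fun p => ha.norm_multOp_le f _ _) g.integrable
  have eq_fst : ∫ x, ⟪multOp (a x) f x, g x⟫_ℂ =
      ∫ u, ∫ x, ⟪κ u • multOp (a x) f (x - u), g x⟫_ℂ := by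
    simp only [ha.inner_multOp_eq_integral haθ f]
    exact integral_integral_swap hfst
  have eq_snd : ∫ x, ⟪multOp (a x) f x, fourierMultiplierCLM G θ g x⟫_ℂ =
      ∫ u, ∫ x, ⟪κ u • multOp (a (x - u)) f (x - u), g x⟫_ℂ := by
    simp only [fourierMultiplierCLM_apply_eq_integral, ← conj_fourierInv hθ]
    exact integral_inner_convolution hκ hcont (fun x => ha.norm_multOp_le f _ _) g
  rw [eq_fst, eq_snd, ← integral_prod_symm _ hfst, ← integral_prod_symm _ hsnd,
    ← integral_sub' hfst hsnd, integral_prod_symm _ (hfst.sub hsnd)]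
  simp only [Pi.sub_apply, ha.multOp_sub, smul_sub, inner_sub_left]

theorem enorm_integral_inner_sub_fourierMultiplierCLM_le (ha : IsBoundedSymbol a A) {θ : 𝓢(V, ℂ)}
    (hθ : ∀ ξ, starRingEnd ℂ (θ ξ) = θ ξ) (haθ : ∀ x ξ, θ ξ • a x ξ = a x ξ) (f : 𝓢(V, F))
    (g : 𝓢(V, G)) :
    ‖(∫ x, ⟪multOp (a x) f x, g x⟫_ℂ) -
        ∫ x, ⟪multOp (a x) f x, fourierMultiplierCLM G θ g x⟫_ℂ‖ₑ ≤
      ∫⁻ u, ‖𝓕⁻ (θ : V → ℂ) u‖ₑ * (eLpNorm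
        (fun x => multOp (fun ξ => a x ξ - a (x - u) ξ) f (x - u)) 2 volume *
          eLpNorm g 2 volume) := by
  rw [ha.integral_inner_sub_fourierMultiplierCLM hθ haθ]
  refine (enorm_integral_le_lintegral_enorm _).trans (lintegral_mono fun u => ?_)
  have hcont : Continuous fun x => multOp (fun ξ => a x ξ - a (x - u) ξ) f (x - u) := by
    simp only [ha.multOp_sub]
    exact (ha.continuous_multOp f continuous_id (continuous_sub_right u)).sub
      (ha.continuous_multOp f (continuous_sub_right u) (continuous_sub_right u))
  simp only [inner_smul_left, integral_const_mul, enorm_mul, RCLike.enorm_conj]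
  gcongr
  exact enorm_integral_inner_le hcont.aestronglyMeasurable g.continuous.aestronglyMeasurable

end IsBoundedSymbol

end Commutator

section DyadicDini

/-- A modulus of continuity on `[0, ∞)` with `∑ ω(2⁻ʲ)² < ∞`: the square Dini condition
`∫₀¹ ω(t)² dt/t < ∞` in dyadic form. -/
structure IsSquareDini (ω : ℝ → ℝ) : Prop where
  nonneg : ∀ t, 0 ≤ t → 0 ≤ ω t
  mono : MonotoneOn ω (Set.Ici 0)
  summable : Summable fun j : ℕ => ω ((2 ^ j)⁻¹) ^ 2

namespace IsSquareDini

variable {ω : ℝ → ℝ}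

theorem exists_modulus_lt (hω : IsSquareDini ω) {ε : ℝ} (hε : 0 < ε) :
    ∃ δ > 0, ∀ t, 0 ≤ t → t < δ → ω t < ε := by
  obtain ⟨j, hj⟩ := (hω.summable.tendsto_atTop_zero.eventually_lt_const (sq_pos_of_pos hε)).exists
  refine ⟨(2 ^ j)⁻¹, by positivity, fun t ht htj => ?_⟩
  exact (hω.mono ht (Set.mem_Ici.2 (by positivity)) htj.le).trans_lt
    (lt_of_pow_lt_pow_left₀ 2 hε.le hj)

theorem continuous_of_norm_sub_le {E F : Type*} [NormedAddCommGroup E] [NormedAddCommGroup F]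
    {g : E → F} {B : ℝ} (hω : IsSquareDini ω) (hg : ∀ x x', ‖g x - g x'‖ ≤ B * ω ‖x - x'‖) :
    Continuous g := by
  refine Metric.continuous_iff.2 fun x' ε hε => ?_
  obtain ⟨δ, hδ, hωδ⟩ := hω.exists_modulus_lt (ε := ε / (|B| + 1)) (by positivity)
  refine ⟨δ, hδ, fun x hx => ?_⟩
  rw [dist_eq_norm] at hx ⊢
  have hω₀ := hω.nonneg _ (norm_nonneg (x - x'))
  calc ‖g x - g x'‖ ≤ B * ω ‖x - x'‖ := hg x x'
    _ ≤ (|B| + 1) * ω ‖x - x'‖ := by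
        gcongr
        linarith [le_abs_self B]
    _ < ε := by
        rw [← lt_div_iff₀' (by positivity)]
        exact hωδ _ (norm_nonneg _) hx

theorem exists_sum_sq_le (hω : IsSquareDini ω) :
    ∃ D : ℝ≥0, ∀ J, ∑ j ∈ Finset.range J,
      ENNReal.ofReal (ω ((2 ^ j)⁻¹) + (2 ^ j)⁻¹) ^ 2 ≤ (D : ℝ≥0∞) ^ 2 := by
  have geometric : Summable fun j : ℕ => (((2 : ℝ) ^ j)⁻¹) ^ 2 := by
    refine (summable_geometric_of_lt_one (r := (4 : ℝ)⁻¹) (by norm_num) (by norm_num)).congr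
      fun j => ?_
    rw [← inv_pow, pow_right_comm]
    norm_num
  have summable : Summable fun j : ℕ => (ω ((2 ^ j)⁻¹) + (2 ^ j)⁻¹) ^ 2 :=
    ((hω.summable.add geometric).mul_left 2).of_nonneg_of_le (fun j => sq_nonneg _)
      fun j => add_sq_le
  refine ⟨NNReal.sqrt (∑' j : ℕ, (ω ((2 ^ j)⁻¹) + (2 ^ j)⁻¹) ^ 2).toNNReal, fun J => ?_⟩
  have h₀ (j : ℕ) : 0 ≤ ω ((2 ^ j)⁻¹) + ((2 : ℝ) ^ j)⁻¹ :=
    add_nonneg (hω.nonneg _ (by positivity)) (by positivity)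
  calc ∑ j ∈ Finset.range J, ENNReal.ofReal (ω ((2 ^ j)⁻¹) + (2 ^ j)⁻¹) ^ 2
      = ENNReal.ofReal (∑ j ∈ Finset.range J, (ω ((2 ^ j)⁻¹) + (2 ^ j)⁻¹) ^ 2) := by
        rw [ENNReal.ofReal_sum_of_nonneg fun j _ => sq_nonneg _]
        simp only [ENNReal.ofReal_pow (h₀ _)]
    _ ≤ ENNReal.ofReal (∑' j : ℕ, (ω ((2 ^ j)⁻¹) + (2 ^ j)⁻¹) ^ 2) :=
        ENNReal.ofReal_le_ofReal (summable.sum_le_tsum _ fun j _ => sq_nonneg _)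
    _ = _ := by rw [← ENNReal.coe_pow, NNReal.sq_sqrt, ENNReal.ofReal]

end IsSquareDini

end DyadicDini

section RoughSymbol

variable {n N : ℕ}

namespace HasSymbolBound

variable {E : Type*} [NormedAddCommGroup E] [NormedSpace ℝ E]
  {b b' : EuclideanSpace ℝ (Fin n) → E} {B B' : ℝ}

theorem mono (hb : HasSymbolBound N b B) (h : B ≤ B') : HasSymbolBound N b B' where
  contDiff := hb.contDiff
  norm_le ξ := (hb.norm_le ξ).trans h
  norm_partialD_le i k hk ξ := by
    have := one_le_bracket ξ
    exact (hb.norm_partialD_le i k hk ξ).trans (by gcongr)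

theorem sub (hb : HasSymbolBound N b B) (hb' : HasSymbolBound N b' B') :
    HasSymbolBound N (fun ξ => b ξ - b' ξ) (B + B') where
  contDiff := hb.contDiff.sub hb'.contDiff
  norm_le ξ := (norm_sub_le _ _).trans (add_le_add (hb.norm_le ξ) (hb'.norm_le ξ))
  norm_partialD_le i k hk ξ := by
    have hkN : (k : WithTop ℕ∞) ≤ N := by exact_mod_cast hk
    rw [iterate_partialD_sub (hb.contDiff.of_le hkN) (hb'.contDiff.of_le hkN), add_mul]
    exact (norm_sub_le _ _).trans
      (add_le_add (hb.norm_partialD_le i k hk ξ) (hb'.norm_partialD_le i k hk ξ))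

end HasSymbolBound

/-- A symbol `b(x, ξ)` of order zero in `ξ` that has modulus of continuity `ω` in `x`. -/
structure RoughSymbol {E : Type*} [NormedAddCommGroup E] [NormedSpace ℝ E] (N : ℕ)
    (b : EuclideanSpace ℝ (Fin n) → EuclideanSpace ℝ (Fin n) → E) (B : ℝ) (ω : ℝ → ℝ) : Prop where
  bound : ∀ x, HasSymbolBound N (b x) B
  modulus : ∀ x x', HasSymbolBound N (fun ξ => b x ξ - b x' ξ) (B * ω ‖x - x'‖)

namespace RoughSymbol

variable {B : ℝ} {ω : ℝ → ℝ}

/-- The modulus of continuity controls small distances and the uniform bound large ones. -/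
theorem hasSymbolBound_sub {E : Type*} [NormedAddCommGroup E] [NormedSpace ℝ E]
    {b : EuclideanSpace ℝ (Fin n) → EuclideanSpace ℝ (Fin n) → E} (hb : RoughSymbol N b B ω)
    (hω : IsSquareDini ω) {r : ℝ} (hr : 0 < r) (x x' : EuclideanSpace ℝ (Fin n)) :
    HasSymbolBound N (fun ξ => b x ξ - b x' ξ)
      (2 * B * (ω r + r) * (1 + (r ^ 2)⁻¹ * ‖x - x'‖)) := by
  have hB := (hb.bound x).nonneg
  have hωr := hω.nonneg r hr.le
  rcases le_total ‖x - x'‖ r with near | far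
  · refine (hb.modulus x x').mono ?_
    have hle : ω ‖x - x'‖ ≤ ω r := hω.mono (norm_nonneg _) hr.le near
    calc B * ω ‖x - x'‖ ≤ B * (2 * (ω r + r)) := by
          gcongr
          linarith
      _ = 2 * B * (ω r + r) * 1 := by ring
      _ ≤ 2 * B * (ω r + r) * (1 + (r ^ 2)⁻¹ * ‖x - x'‖) := by
          gcongr
          exact le_add_of_nonneg_right (by positivity)
  · refine ((hb.bound x).sub (hb.bound x')).mono ?_
    calc B + B = 2 * B * r * ((r ^ 2)⁻¹ * r) := by
          field_simp
          norm_num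
      _ ≤ 2 * B * (ω r + r) * (1 + (r ^ 2)⁻¹ * ‖x - x'‖) := by
          gcongr
          · exact le_add_of_nonneg_left hωr
          · exact (mul_le_mul_of_nonneg_left far (by positivity)).trans (by linarith)

variable {F G : Type*} [NormedAddCommGroup F] [InnerProductSpace ℂ F] [NormedAddCommGroup G]
  [InnerProductSpace ℂ G]
  {b : EuclideanSpace ℝ (Fin n) → EuclideanSpace ℝ (Fin n) → (F →L[ℂ] G)}

theorem isBoundedSymbol (hb : RoughSymbol N b B ω) (hω : IsSquareDini ω) :
    IsBoundedSymbol b B where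
  continuous_left ξ := hω.continuous_of_norm_sub_le fun x x' => (hb.modulus x x').norm_le ξ
  continuous_right x := (hb.bound x).contDiff.continuous
  norm_le x := (hb.bound x).norm_le

end RoughSymbol

end RoughSymbol

section Bands

variable {V F G : Type*} [NormedAddCommGroup V] [InnerProductSpace ℝ V] [NormedAddCommGroup F]
  [InnerProductSpace ℂ F] [NormedAddCommGroup G] [InnerProductSpace ℂ G]

/-- The part of the symbol `b` at frequencies `|ξ| ≲ 4 ^ j`. -/
noncomputable def lowPart (j : ℕ) (b : V → (F →L[ℂ] G)) (ξ : V) : F →L[ℂ] G :=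
  lowCut (((4 : ℝ) ^ j)⁻¹ • ξ) • b ξ

/-- The part of the symbol `b` at frequencies `|ξ| ∼ 4 ^ j`. -/
noncomputable def bandPart (j : ℕ) (b : V → (F →L[ℂ] G)) (ξ : V) : F →L[ℂ] G :=
  bandCut (((4 : ℝ) ^ j)⁻¹ • ξ) • b ξ

theorem bandPart_sub (j : ℕ) (b b' : V → (F →L[ℂ] G)) (ξ : V) :
    bandPart j (fun ξ => b ξ - b' ξ) ξ = bandPart j b ξ - bandPart j b' ξ :=
  smul_sub _ _ _

variable [FiniteDimensional ℝ V]

theorem wideSymbol_smul_bandPart (j : ℕ) (b : V → (F →L[ℂ] G)) (ξ : V) :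
    wideSymbol V j ξ • bandPart j b ξ = bandPart j b ξ := by
  rw [bandPart, wideSymbol_apply, Complex.coe_smul, smul_smul, wideCut_mul_bandCut]

variable {a : V → V → (F →L[ℂ] G)} {A : ℝ}

theorem isBoundedSymbol_lowPart (ha : IsBoundedSymbol a A) (j : ℕ) :
    IsBoundedSymbol (fun x => lowPart j (a x)) A := by
  have h := ha.smul (contDiff_lowCut.continuous.comp (continuous_const_smul (((4 : ℝ) ^ j)⁻¹)))
    fun ξ => norm_lowCut_le_one _
  rwa [one_mul] at h

theorem isBoundedSymbol_bandPart (ha : IsBoundedSymbol a A) (j : ℕ) :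
    IsBoundedSymbol (fun x => bandPart j (a x)) A := by
  have h := ha.smul (contDiff_bandCut.continuous.comp (continuous_const_smul (((4 : ℝ) ^ j)⁻¹)))
    fun ξ => norm_bandCut_le_one _
  rwa [one_mul] at h

variable [MeasurableSpace V] [BorelSpace V]

theorem multOp_lowPart_succ (ha : IsBoundedSymbol a A) (j : ℕ) (f : 𝓢(V, F)) (x : V) :
    multOp (lowPart (j + 1) (a x)) f x =
      multOp (lowPart j (a x)) f x + multOp (bandPart j (a x)) f x := by
  simp only [multOp_apply]
  rw [← integral_add ((isBoundedSymbol_lowPart ha j).integrable_fourierChar_smul f x x)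
    ((isBoundedSymbol_bandPart ha j).integrable_fourierChar_smul f x x)]
  congr 1 with ξ
  rw [lowPart, lowCut_inv_pow_succ, add_smul, add_apply, smul_add, lowPart, bandPart]

end Bands

section PieceBounds

variable {n N : ℕ} (F G : Type*) [NormedAddCommGroup F] [InnerProductSpace ℂ F] [CompleteSpace F]
  [NormedAddCommGroup G] [InnerProductSpace ℂ G] [CompleteSpace G]

theorem exists_eLpNorm_multOp_lowPart_zero_le (hN : n < 2 * N) : ∃ K : ℝ≥0,
    ∀ (b : EuclideanSpace ℝ (Fin n) → EuclideanSpace ℝ (Fin n) → (F →L[ℂ] G)) (B : ℝ),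
      (∀ x, HasSymbolBound N (b x) B) → ∀ f : 𝓢(EuclideanSpace ℝ (Fin n), F),
      eLpNorm (fun x => multOp (lowPart 0 (b x)) f x) 2 volume ≤
        K * ENNReal.ofReal B * eLpNorm f 2 volume := by
  obtain ⟨K, hK⟩ := exists_eLpNorm_multOp_cutoff_le F G hN contDiff_lowCut hasCompactSupport_lowCut
  refine ⟨K, fun b B hb f => ?_⟩
  unfold lowPart
  simpa only [sub_zero, pow_zero] using hK 1 one_pos (fun ξ _ => one_le_bracket _) b B hb f 0

theorem exists_eLpNorm_multOp_bandPart_le (hN : n < 2 * N) : ∃ K : ℝ≥0,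
    ∀ (b : EuclideanSpace ℝ (Fin n) → EuclideanSpace ℝ (Fin n) → (F →L[ℂ] G)) (B : ℝ),
      (∀ x, HasSymbolBound N (b x) B) →
      ∀ (j : ℕ) (f : 𝓢(EuclideanSpace ℝ (Fin n), F)) (u : EuclideanSpace ℝ (Fin n)),
      eLpNorm (fun x => multOp (bandPart j (b x)) f (x - u)) 2 volume ≤
        K * ENNReal.ofReal B * eLpNorm (wideProj j f) 2 volume := by
  obtain ⟨K, hK⟩ :=
    exists_eLpNorm_multOp_cutoff_le F G hN contDiff_bandCut hasCompactSupport_bandCut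
  refine ⟨K, fun b B hb j f u => ?_⟩
  have le_bracket (ξ : EuclideanSpace ℝ (Fin n)) (hξ : ξ ∈ tsupport bandCut) :
      (4 : ℝ) ^ j ≤ bracket ((4 : ℝ) ^ j • ξ) := by
    refine le_trans ?_ (norm_le_bracket _)
    rw [norm_smul, Real.norm_of_nonneg (by positivity)]
    exact le_mul_of_one_le_right (by positivity) (one_le_norm_of_mem_tsupport_bandCut hξ)
  have localize (x : EuclideanSpace ℝ (Fin n)) :
      multOp (bandPart j (b x)) (wideProj j f) = multOp (bandPart j (b x)) f :=
    multOp_fourierMultiplierCLM (wideSymbol_smul_bandPart j (b x)) f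
  simp only [← localize]
  exact hK _ (by positivity) le_bracket b B hb (wideProj j f) u

end PieceBounds

section BandPairing

variable {n N : ℕ} {F G : Type*} [NormedAddCommGroup F] [InnerProductSpace ℂ F] [CompleteSpace F]
  [NormedAddCommGroup G] [InnerProductSpace ℂ G] [CompleteSpace G]
  {b : EuclideanSpace ℝ (Fin n) → EuclideanSpace ℝ (Fin n) → (F →L[ℂ] G)} {B : ℝ} {ω : ℝ → ℝ}

theorem RoughSymbol.exists_eLpNorm_multOp_bandPart_sub_le (hN : n < 2 * N) (hω : IsSquareDini ω)
    (hb : RoughSymbol N b B ω) : ∃ K : ℝ≥0,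
    ∀ (j : ℕ) (f : 𝓢(EuclideanSpace ℝ (Fin n), F)) (u : EuclideanSpace ℝ (Fin n)),
      eLpNorm (fun x => multOp (fun ξ => bandPart j (b x) ξ - bandPart j (b (x - u)) ξ) f (x - u))
          2 volume ≤
        K * (ENNReal.ofReal (ω ((2 ^ j)⁻¹) + (2 ^ j)⁻¹) * eLpNorm (wideProj j f) 2 volume) *
          ENNReal.ofReal (1 + 4 ^ j * ‖u‖) := by
  obtain ⟨K, hK⟩ := exists_eLpNorm_multOp_bandPart_le F G hN
  refine ⟨K * (2 * B).toNNReal, fun j f u => ?_⟩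
  have hB : 0 ≤ 2 * B := mul_nonneg zero_le_two (hb.bound 0).nonneg
  have hω₀ := hω.nonneg (2 ^ j)⁻¹ (by positivity)
  have hδ (x : EuclideanSpace ℝ (Fin n)) : HasSymbolBound N (fun ξ => b x ξ - b (x - u) ξ)
      (2 * B * (ω ((2 ^ j)⁻¹) + (2 ^ j)⁻¹) * (1 + 4 ^ j * ‖u‖)) := by
    have h := hb.hasSymbolBound_sub hω (r := (2 ^ j)⁻¹) (by positivity) x (x - u)
    rwa [sub_sub_cancel, inv_pow, inv_inv, pow_right_comm,
      show (2 : ℝ) ^ 2 = 4 by norm_num] at h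
  simp only [← bandPart_sub]
  refine (hK _ _ hδ j f u).trans_eq ?_
  rw [ENNReal.ofReal_mul (by positivity), ENNReal.ofReal_mul hB, ENNReal.coe_mul]
  change _ = K * ENNReal.ofReal (2 * B) * _ * _
  ring

theorem RoughSymbol.exists_enorm_integral_inner_bandPart_sub_wideProj_le (hN : n < 2 * N)
    (hω : IsSquareDini ω) (hb : RoughSymbol N b B ω) : ∃ K : ℝ≥0,
    ∀ (j : ℕ) (f : 𝓢(EuclideanSpace ℝ (Fin n), F)) (g : 𝓢(EuclideanSpace ℝ (Fin n), G)),
      ‖(∫ x, ⟪multOp (bandPart j (b x)) f x, g x⟫_ℂ) -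
          ∫ x, ⟪multOp (bandPart j (b x)) f x, wideProj j g x⟫_ℂ‖ₑ ≤
        K * (ENNReal.ofReal (ω ((2 ^ j)⁻¹) + (2 ^ j)⁻¹) * eLpNorm (wideProj j f) 2 volume *
          eLpNorm g 2 volume) := by
  obtain ⟨K, hK⟩ := hb.exists_eLpNorm_multOp_bandPart_sub_le hN hω
  obtain ⟨c, hc⟩ := exists_lintegral_wideKernel_le (V := EuclideanSpace ℝ (Fin n))
  refine ⟨K * c, fun j f g => ?_⟩
  set ε := ENNReal.ofReal (ω ((2 ^ j)⁻¹) + (2 ^ j)⁻¹) * eLpNorm (wideProj j f) 2 volume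
  have measurable_kernel : Measurable fun u =>
      ‖𝓕⁻ (wideSymbol _ j : EuclideanSpace ℝ (Fin n) → ℂ) u‖ₑ *
        ENNReal.ofReal (1 + 4 ^ j * ‖u‖) := by
    rw [← SchwartzMap.fourierInv_coe]
    exact (SchwartzMap.continuous _).enorm.measurable.mul (by fun_prop)
  calc _ ≤ ∫⁻ u, ‖𝓕⁻ (wideSymbol _ j : EuclideanSpace ℝ (Fin n) → ℂ) u‖ₑ *
          (K * ε * ENNReal.ofReal (1 + 4 ^ j * ‖u‖) * eLpNorm g 2 volume) := by
        refine ((isBoundedSymbol_bandPart (hb.isBoundedSymbol hω)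
          j).enorm_integral_inner_sub_fourierMultiplierCLM_le (conj_wideSymbol j)
          (fun x => wideSymbol_smul_bandPart j (b x)) f g).trans (lintegral_mono fun u => ?_)
        gcongr
        exact hK j f u
    _ = K * (ε * eLpNorm g 2 volume) *
          ∫⁻ u, ‖𝓕⁻ (wideSymbol _ j : EuclideanSpace ℝ (Fin n) → ℂ) u‖ₑ *
            ENNReal.ofReal (1 + 4 ^ j * ‖u‖) := by
        rw [← lintegral_const_mul _ measurable_kernel]
        congr 1 with u
        ring
    _ ≤ K * (ε * eLpNorm g 2 volume) * c := by
        gcongr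
        exact hc j
    _ = _ := by
        push_cast
        ring

theorem RoughSymbol.exists_enorm_integral_inner_bandPart_le (hN : n < 2 * N)
    (hω : IsSquareDini ω) (hb : RoughSymbol N b B ω) : ∃ K : ℝ≥0,
    ∀ (j : ℕ) (f : 𝓢(EuclideanSpace ℝ (Fin n), F)) (g : 𝓢(EuclideanSpace ℝ (Fin n), G)),
      ‖∫ x, ⟪multOp (bandPart j (b x)) f x, g x⟫_ℂ‖ₑ ≤
        K * (eLpNorm (wideProj j f) 2 volume * eLpNorm (wideProj j g) 2 volume +
          ENNReal.ofReal (ω ((2 ^ j)⁻¹) + (2 ^ j)⁻¹) * eLpNorm (wideProj j f) 2 volume *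
            eLpNorm g 2 volume) := by
  obtain ⟨K, hK⟩ := exists_eLpNorm_multOp_bandPart_le F G hN
  obtain ⟨K', hK'⟩ := hb.exists_enorm_integral_inner_bandPart_sub_wideProj_le hN hω
  refine ⟨K * B.toNNReal + K', fun j f g => ?_⟩
  have hcont : Continuous fun x => multOp (bandPart j (b x)) f x :=
    (isBoundedSymbol_bandPart (hb.isBoundedSymbol hω) j).continuous_multOp f continuous_id
      continuous_id
  have localized : ‖∫ x, ⟪multOp (bandPart j (b x)) f x, wideProj j g x⟫_ℂ‖ₑ ≤
      K * ENNReal.ofReal B * (eLpNorm (wideProj j f) 2 volume *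
        eLpNorm (wideProj j g) 2 volume) := by
    rw [← mul_assoc]
    refine (enorm_integral_inner_le hcont.aestronglyMeasurable
      (wideProj j g).continuous.aestronglyMeasurable).trans ?_
    gcongr
    simpa only [sub_zero] using hK b B hb.bound j f 0
  rw [← sub_add_cancel (∫ x, ⟪multOp (bandPart j (b x)) f x, g x⟫_ℂ)
    (∫ x, ⟪multOp (bandPart j (b x)) f x, wideProj j g x⟫_ℂ)]
  refine ((enorm_add_le _ _).trans (add_le_add (hK' j f g) localized)).trans ?_
  rw [ENNReal.coe_add, ENNReal.coe_mul, add_mul, mul_add, mul_add, add_comm, ENNReal.ofReal]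
  exact add_le_add le_self_add le_add_self

end BandPairing

section Truncation

theorem IsBoundedSymbol.integrable_inner_multOp {V F G : Type*} [NormedAddCommGroup V]
    [InnerProductSpace ℝ V] [FiniteDimensional ℝ V] [MeasurableSpace V] [BorelSpace V]
    [NormedAddCommGroup F] [InnerProductSpace ℂ F] [NormedAddCommGroup G] [InnerProductSpace ℂ G]
    {a : V → V → (F →L[ℂ] G)} {A : ℝ} (ha : IsBoundedSymbol a A) (f : 𝓢(V, F)) (g : 𝓢(V, G)) :
    Integrable fun x => ⟪multOp (a x) f x, g x⟫_ℂ :=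
  (g.integrable.norm.const_mul (A * ∫ ξ, ‖𝓕 f ξ‖)).mono'
    ((ha.continuous_multOp f continuous_id continuous_id).inner g.continuous).aestronglyMeasurable
    (Filter.Eventually.of_forall fun x => (norm_inner_le_norm _ _).trans
      (mul_le_mul_of_nonneg_right (ha.norm_multOp_le f x x) (norm_nonneg _)))

namespace RoughSymbol

variable {n N : ℕ} {F G : Type*} [NormedAddCommGroup F] [InnerProductSpace ℂ F]
  [NormedAddCommGroup G] [InnerProductSpace ℂ G]
  {b : EuclideanSpace ℝ (Fin n) → EuclideanSpace ℝ (Fin n) → (F →L[ℂ] G)} {B : ℝ} {ω : ℝ → ℝ}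

theorem integral_inner_multOp_lowPart (hω : IsSquareDini ω) (hb : RoughSymbol N b B ω) (J : ℕ)
    (f : 𝓢(EuclideanSpace ℝ (Fin n), F)) (g : 𝓢(EuclideanSpace ℝ (Fin n), G)) :
    ∫ x, ⟪multOp (lowPart J (b x)) f x, g x⟫_ℂ =
      (∫ x, ⟪multOp (lowPart 0 (b x)) f x, g x⟫_ℂ) +
        ∑ j ∈ Finset.range J, ∫ x, ⟪multOp (bandPart j (b x)) f x, g x⟫_ℂ := by
  have ha := hb.isBoundedSymbol hω
  induction J with
  | zero => simp
  | succ J ih =>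
    rw [Finset.sum_range_succ, ← add_assoc, ← ih]
    simp only [multOp_lowPart_succ ha, inner_add_left]
    exact integral_add ((isBoundedSymbol_lowPart ha J).integrable_inner_multOp f g)
      ((isBoundedSymbol_bandPart ha J).integrable_inner_multOp f g)

variable [CompleteSpace F] [CompleteSpace G]

theorem memLp_multOp_lowPart (hN : n < 2 * N) (hω : IsSquareDini ω) (hb : RoughSymbol N b B ω)
    (J : ℕ) (f : 𝓢(EuclideanSpace ℝ (Fin n), F)) :
    MemLp (fun x => multOp (lowPart J (b x)) f x) 2 := by
  have ha := hb.isBoundedSymbol hω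
  induction J with
  | zero =>
    obtain ⟨K, hK⟩ := exists_eLpNorm_multOp_lowPart_zero_le F G hN
    exact ⟨((isBoundedSymbol_lowPart ha 0).continuous_multOp f continuous_id
      continuous_id).aestronglyMeasurable, (hK b B hb.bound f).trans_lt
        (ENNReal.mul_lt_top
        (ENNReal.mul_lt_top ENNReal.coe_lt_top ENNReal.ofReal_lt_top) (f.memLp 2 volume).2)⟩
  | succ J ih =>
    obtain ⟨K, hK⟩ := exists_eLpNorm_multOp_bandPart_le F G hN
    simp only [multOp_lowPart_succ ha]
    refine ih.add ⟨((isBoundedSymbol_bandPart ha J).continuous_multOp f continuous_id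
      continuous_id).aestronglyMeasurable, ?_⟩
    have h := hK b B hb.bound J f 0
    simp only [sub_zero] at h
    exact h.trans_lt (ENNReal.mul_lt_top
      (ENNReal.mul_lt_top ENNReal.coe_lt_top ENNReal.ofReal_lt_top)
      ((wideProj J f).memLp 2 volume).2)

/-- Cauchy–Schwarz in `j`: both factors of the localized pairings are square summable by almost
orthogonality, and the commutators by the square Dini condition. -/
theorem exists_sum_enorm_integral_inner_bandPart_le (hN : n < 2 * N) (hω : IsSquareDini ω)
    (hb : RoughSymbol N b B ω) : ∃ K : ℝ≥0, ∀ (J : ℕ) (f : 𝓢(EuclideanSpace ℝ (Fin n), F))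
      (g : 𝓢(EuclideanSpace ℝ (Fin n), G)),
      ∑ j ∈ Finset.range J, ‖∫ x, ⟪multOp (bandPart j (b x)) f x, g x⟫_ℂ‖ₑ ≤
        K * eLpNorm f 2 volume * eLpNorm g 2 volume := by
  obtain ⟨K, hK⟩ := hb.exists_enorm_integral_inner_bandPart_le hN hω
  obtain ⟨D, hD⟩ := hω.exists_sum_sq_le
  refine ⟨K * (4 + 2 * D), fun J f g => ?_⟩
  set ε : ℕ → ℝ≥0∞ := fun j => ENNReal.ofReal (ω ((2 ^ j)⁻¹) + (2 ^ j)⁻¹)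
  have localized : ∑ j ∈ Finset.range J,
      eLpNorm (wideProj j f) 2 volume * eLpNorm (wideProj j g) 2 volume ≤
        2 * eLpNorm f 2 volume * (2 * eLpNorm g 2 volume) :=
    sum_mul_le_of_sum_sq_le (sum_eLpNorm_wideProj_sq_le J f) (sum_eLpNorm_wideProj_sq_le J g)
  have commutator : ∑ j ∈ Finset.range J, ε j * eLpNorm (wideProj j f) 2 volume ≤
      D * (2 * eLpNorm f 2 volume) :=
    sum_mul_le_of_sum_sq_le (hD J) (sum_eLpNorm_wideProj_sq_le J f)
  calc ∑ j ∈ Finset.range J, ‖∫ x, ⟪multOp (bandPart j (b x)) f x, g x⟫_ℂ‖ₑ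
      ≤ ∑ j ∈ Finset.range J, K * (eLpNorm (wideProj j f) 2 volume *
          eLpNorm (wideProj j g) 2 volume +
            ε j * eLpNorm (wideProj j f) 2 volume * eLpNorm g 2 volume) :=
        Finset.sum_le_sum fun j _ => hK j f g
    _ = K * (∑ j ∈ Finset.range J, eLpNorm (wideProj j f) 2 volume *
          eLpNorm (wideProj j g) 2 volume +
            (∑ j ∈ Finset.range J, ε j * eLpNorm (wideProj j f) 2 volume) *
              eLpNorm g 2 volume) := by
        rw [← Finset.mul_sum, Finset.sum_add_distrib, Finset.sum_mul]
    _ ≤ K * (2 * eLpNorm f 2 volume * (2 * eLpNorm g 2 volume) +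
          D * (2 * eLpNorm f 2 volume) * eLpNorm g 2 volume) := by gcongr
    _ = _ := by
        push_cast
        ring

theorem exists_enorm_integral_inner_lowPart_le (hN : n < 2 * N) (hω : IsSquareDini ω)
    (hb : RoughSymbol N b B ω) : ∃ K : ℝ≥0, ∀ (J : ℕ) (f : 𝓢(EuclideanSpace ℝ (Fin n), F))
      (g : 𝓢(EuclideanSpace ℝ (Fin n), G)),
      ‖∫ x, ⟪multOp (lowPart J (b x)) f x, g x⟫_ℂ‖ₑ ≤
        K * eLpNorm f 2 volume * eLpNorm g 2 volume := by
  obtain ⟨K, hK⟩ := exists_eLpNorm_multOp_lowPart_zero_le F G hN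
  obtain ⟨K', hK'⟩ := hb.exists_sum_enorm_integral_inner_bandPart_le hN hω
  refine ⟨K * B.toNNReal + K', fun J f g => ?_⟩
  have lowest : ‖∫ x, ⟪multOp (lowPart 0 (b x)) f x, g x⟫_ℂ‖ₑ ≤
      K * ENNReal.ofReal B * eLpNorm f 2 volume * eLpNorm g 2 volume :=
    (enorm_integral_inner_le (hb.memLp_multOp_lowPart hN hω 0 f).1
      g.continuous.aestronglyMeasurable).trans (mul_le_mul_left (hK b B hb.bound f) _)
  calc ‖∫ x, ⟪multOp (lowPart J (b x)) f x, g x⟫_ℂ‖ₑ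
      ≤ ‖∫ x, ⟪multOp (lowPart 0 (b x)) f x, g x⟫_ℂ‖ₑ +
          ∑ j ∈ Finset.range J, ‖∫ x, ⟪multOp (bandPart j (b x)) f x, g x⟫_ℂ‖ₑ := by
        rw [hb.integral_inner_multOp_lowPart hω]
        exact (enorm_add_le _ _).trans (add_le_add_right (enorm_sum_le _ _) _)
    _ ≤ K * ENNReal.ofReal B * eLpNorm f 2 volume * eLpNorm g 2 volume +
          K' * eLpNorm f 2 volume * eLpNorm g 2 volume := add_le_add lowest (hK' J f g)
    _ = _ := by
        rw [ENNReal.ofReal]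
        push_cast
        ring

end RoughSymbol

end Truncation

section Extension

theorem eLpNorm_two_le_of_enorm_integral_inner_le {V G : Type*} [NormedAddCommGroup V]
    [InnerProductSpace ℝ V] [FiniteDimensional ℝ V] [MeasurableSpace V] [BorelSpace V]
    [NormedAddCommGroup G] [InnerProductSpace ℂ G] {Φ : V → G} (hΦ : MemLp Φ 2) {M : ℝ≥0}
    (h : ∀ g : 𝓢(V, G), ‖∫ x, ⟪Φ x, g x⟫_ℂ‖ₑ ≤ M * eLpNorm g 2 volume) :
    eLpNorm Φ 2 volume ≤ M := by
  have inner_le (g : Lp G 2 (volume : Measure V)) : ‖⟪hΦ.toLp Φ, g⟫_ℂ‖ₑ ≤ M * ‖g‖ₑ := by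
    refine DenseRange.induction_on (SchwartzMap.denseRange_toLpCLM (F := G) (p := 2)
      (μ := (volume : Measure V)) ENNReal.ofNat_ne_top) g
      (isClosed_le (by fun_prop) (ENNReal.continuous_const_mul ENNReal.coe_ne_top |>.comp
        continuous_enorm)) fun g => ?_
    have pairing_eq : ∫ x, ⟪hΦ.toLp Φ x, g.toLp 2 volume x⟫_ℂ = ∫ x, ⟪Φ x, g x⟫_ℂ := by
      refine integral_congr_ae ?_
      filter_upwards [hΦ.coeFn_toLp, g.coeFn_toLp 2 volume] with x hx hgx
      rw [hx, hgx]
    rw [SchwartzMap.toLpCLM_apply, L2.inner_def, pairing_eq, SchwartzMap.toLp, Lp.enorm_toLp]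
    exact h g
  have self_le : ‖hΦ.toLp Φ‖ₑ * ‖hΦ.toLp Φ‖ₑ ≤ M * ‖hΦ.toLp Φ‖ₑ := by
    have h := inner_le (hΦ.toLp Φ)
    rwa [inner_self_eq_norm_sq_to_K, enorm_pow, sq, RCLike.ofReal_eq_complex_ofReal,
      enorm_eq_iff_norm_eq.2 (Complex.norm_real _), enorm_norm] at h
  rw [← Lp.enorm_toLp hΦ]
  rcases eq_or_ne ‖hΦ.toLp Φ‖ₑ 0 with h₀ | h₀
  · rw [h₀]
    exact zero_le
  · exact (ENNReal.mul_le_mul_iff_left h₀ enorm_ne_top).1 self_le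

namespace IsBoundedSymbol

variable {V F G : Type*} [NormedAddCommGroup V] [InnerProductSpace ℝ V] [FiniteDimensional ℝ V]
  [MeasurableSpace V] [BorelSpace V] [NormedAddCommGroup F] [InnerProductSpace ℂ F]
  [NormedAddCommGroup G] [InnerProductSpace ℂ G] {a : V → V → (F →L[ℂ] G)} {A : ℝ}

theorem tendsto_multOp_lowPart (ha : IsBoundedSymbol a A) (f : 𝓢(V, F)) (x : V) :
    Filter.Tendsto (fun J : ℕ => multOp (lowPart J (a x)) f x) Filter.atTop
      (nhds (multOp (a x) f x)) := by
  simp only [multOp_apply]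
  refine tendsto_integral_of_dominated_convergence (fun ξ => A * ‖𝓕 f ξ‖)
    (fun J => ((isBoundedSymbol_lowPart ha J).integrable_fourierChar_smul f x x).1)
    ((𝓕 f).integrable.norm.const_mul _)
    (fun J => Filter.Eventually.of_forall fun ξ => ?_) (Filter.Eventually.of_forall fun ξ => ?_)
  · rw [Circle.norm_smul]
    exact (isBoundedSymbol_lowPart ha J).norm_apply_fourier_le f x ξ
  · simpa only [lowPart, smul_apply, smul_comm _ (Real.fourierChar _), one_smul] using
      (tendsto_lowCut ξ).smul_const (Real.fourierChar (inner ℝ ξ x) • a x ξ (𝓕 (f : V → F) ξ))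

theorem multOp_add_right (ha : IsBoundedSymbol a A) (f g : 𝓢(V, F)) (x y : V) :
    multOp (a x) (f + g : 𝓢(V, F)) y = multOp (a x) f y + multOp (a x) g y := by
  rw [multOp_apply, multOp_apply, multOp_apply, ← integral_add
    (ha.integrable_fourierChar_smul f x y) (ha.integrable_fourierChar_smul g x y)]
  simp only [← SchwartzMap.fourier_coe, FourierTransform.fourier_add, add_apply, map_add, smul_add]

end IsBoundedSymbol

theorem multOp_smul_right {V F G : Type*} [NormedAddCommGroup V] [InnerProductSpace ℝ V]
    [FiniteDimensional ℝ V] [MeasurableSpace V] [BorelSpace V] [NormedAddCommGroup F]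
    [InnerProductSpace ℂ F] [NormedAddCommGroup G] [InnerProductSpace ℂ G] (b : V → (F →L[ℂ] G))
    (c : ℂ) (f : 𝓢(V, F)) (y : V) : multOp b (c • f : 𝓢(V, F)) y = c • multOp b f y := by
  simp only [multOp_apply, ← integral_smul, ← SchwartzMap.fourier_coe,
    FourierTransform.fourier_smul, smul_apply, map_smul, smul_comm c]

namespace RoughSymbol

variable {n N : ℕ} {F G : Type*} [NormedAddCommGroup F] [InnerProductSpace ℂ F] [CompleteSpace F]
  [NormedAddCommGroup G] [InnerProductSpace ℂ G] [CompleteSpace G]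
  {b : EuclideanSpace ℝ (Fin n) → EuclideanSpace ℝ (Fin n) → (F →L[ℂ] G)} {B : ℝ} {ω : ℝ → ℝ}

theorem exists_eLpNorm_multOp_le (hN : n < 2 * N) (hω : IsSquareDini ω)
    (hb : RoughSymbol N b B ω) :
    ∃ K : ℝ≥0, ∀ f : 𝓢(EuclideanSpace ℝ (Fin n), F),
      eLpNorm (fun x => multOp (b x) f x) 2 volume ≤ K * eLpNorm f 2 volume := by
  obtain ⟨K, hK⟩ := hb.exists_enorm_integral_inner_lowPart_le hN hω
  refine ⟨K, fun f => ?_⟩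
  lift eLpNorm f 2 volume to ℝ≥0 using (f.memLp 2 volume).2.ne with m hm
  have truncated (J : ℕ) : eLpNorm (fun x => multOp (lowPart J (b x)) f x) 2 volume ≤ K * m :=
    mod_cast eLpNorm_two_le_of_enorm_integral_inner_le (M := K * m)
      (hb.memLp_multOp_lowPart hN hω J f) fun g => by
        rw [ENNReal.coe_mul, hm]
        exact hK J f g
  refine (Lp.eLpNorm_lim_le_liminf_eLpNorm
    (fun J => (hb.memLp_multOp_lowPart hN hω J f).1) _ (Filter.Eventually.of_forall fun x =>
      (hb.isBoundedSymbol hω).tendsto_multOp_lowPart f x)).trans ?_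
  exact Filter.liminf_le_of_le (by isBoundedDefault) fun c hc =>
    hc.exists.elim fun J hJ => hJ.trans (truncated J)

theorem exists_continuousLinearMap_extending_multOp (hN : n < 2 * N) (hω : IsSquareDini ω)
    (hb : RoughSymbol N b B ω) :
    ∃ T : Lp F 2 (volume : Measure (EuclideanSpace ℝ (Fin n))) →L[ℂ]
        Lp G 2 (volume : Measure (EuclideanSpace ℝ (Fin n))),
      ∀ f : 𝓢(EuclideanSpace ℝ (Fin n), F),
        T (f.toLp 2) =ᵐ[volume] fun x => multOp (b x) f x := by
  have ha := hb.isBoundedSymbol hω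
  obtain ⟨K, hK⟩ := hb.exists_eLpNorm_multOp_le hN hω
  have hL2 (f : 𝓢(EuclideanSpace ℝ (Fin n), F)) : MemLp (fun x => multOp (b x) f x) 2 :=
    ⟨(ha.continuous_multOp f continuous_id continuous_id).aestronglyMeasurable,
      (hK f).trans_lt (ENNReal.mul_lt_top ENNReal.coe_lt_top (f.memLp 2 volume).2)⟩
  let L : 𝓢(EuclideanSpace ℝ (Fin n), F) →ₗ[ℂ]
      Lp G 2 (volume : Measure (EuclideanSpace ℝ (Fin n))) :=
    { toFun := fun f => (hL2 f).toLp
      map_add' := fun f g => by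
        rw [← MemLp.toLp_add]
        exact MemLp.toLp_congr _ _ (Filter.Eventually.of_forall fun x =>
          ha.multOp_add_right f g x x)
      map_smul' := fun c f => by
        rw [RingHom.id_apply, ← MemLp.toLp_const_smul]
        exact MemLp.toLp_congr _ _ (Filter.Eventually.of_forall fun x =>
          multOp_smul_right (b x) c f x) }
  let e := (SchwartzMap.toLpCLM ℂ F 2 (volume : Measure (EuclideanSpace ℝ (Fin n)))).toLinearMap
  have hdense : DenseRange e := SchwartzMap.denseRange_toLpCLM ENNReal.ofNat_ne_top
  have hnorm : ∃ K : ℝ, ∀ f, ‖L f‖ ≤ K * ‖e f‖ := by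
    refine ⟨K, fun f => ?_⟩
    have h : ‖L f‖ₑ ≤ K * ‖e f‖ₑ := by
      simpa only [L, e, LinearMap.coe_mk, AddHom.coe_mk, ContinuousLinearMap.coe_coe,
        SchwartzMap.toLpCLM_apply, SchwartzMap.toLp, Lp.enorm_toLp] using hK f
    rw [enorm_eq_nnnorm, enorm_eq_nnnorm] at h
    exact_mod_cast h
  refine ⟨L.extendOfNorm e, fun f => ?_⟩
  have extends_L : L.extendOfNorm e (f.toLp 2) = L f := LinearMap.extendOfNorm_eq hdense hnorm f
  rw [extends_L]
  exact (hL2 f).coeFn_toLp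

end RoughSymbol

end Extension

section DiniIntegral

variable {ω : ℝ → ℝ}

theorem sq_le_two_mul_integral_sq_div (hω₀ : ∀ t, 0 ≤ t → 0 ≤ ω t)
    (hω : MonotoneOn ω (Set.Ici 0)) {r : ℝ} (hr : 0 < r)
    (hi : IntervalIntegrable (fun t => ω t ^ 2 / t) volume r (2 * r)) :
    ω r ^ 2 ≤ 2 * ∫ t in r..(2 * r), ω t ^ 2 / t := by
  have const_le : ∫ _ in r..(2 * r), ω r ^ 2 / (2 * r) ≤ ∫ t in r..(2 * r), ω t ^ 2 / t :=
    intervalIntegral.integral_mono_on (by linarith) (by simp) hi fun t ⟨hrt, ht⟩ => by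
      have ht₀ : 0 < t := hr.trans_le hrt
      have hωr := hω₀ r hr.le
      have hωt : ω r ≤ ω t := hω hr.le ht₀.le hrt
      gcongr
  calc ω r ^ 2 = 2 * ∫ _ in r..(2 * r), ω r ^ 2 / (2 * r) := by
        rw [intervalIntegral.integral_const, smul_eq_mul]
        field_simp
        ring
    _ ≤ _ := by gcongr

theorem sum_sq_dyadic_le_integral (hω₀ : ∀ t, 0 ≤ t → 0 ≤ ω t) (hω : MonotoneOn ω (Set.Ici 0))
    (hi : IntegrableOn (fun t => ω t ^ 2 / t) (Set.Ioc 0 1)) (J : ℕ) :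
    ∑ j ∈ Finset.range J, ω ((2 ^ (j + 1))⁻¹) ^ 2 ≤
      2 * ∫ t in ((2 : ℝ) ^ J)⁻¹..1, ω t ^ 2 / t := by
  have mem_unit (j : ℕ) : ((2 : ℝ) ^ j)⁻¹ ∈ Set.Icc (0 : ℝ) 1 :=
    ⟨by positivity, inv_le_one_of_one_le₀ (one_le_pow₀ one_le_two)⟩
  have integrable {r s : ℝ} (hr : r ∈ Set.Icc (0 : ℝ) 1) (hs : s ∈ Set.Icc (0 : ℝ) 1) :
      IntervalIntegrable (fun t => ω t ^ 2 / t) volume r s := by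
    refine ((intervalIntegrable_iff_integrableOn_Ioc_of_le zero_le_one).2 hi).mono_set ?_
    rw [Set.uIcc_of_le zero_le_one]
    exact Set.uIcc_subset_Icc hr hs
  induction J with
  | zero => simp
  | succ J ih =>
    have double : 2 * ((2 : ℝ) ^ (J + 1))⁻¹ = (2 ^ J)⁻¹ := by
      rw [pow_succ]
      field_simp
    have last := sq_le_two_mul_integral_sq_div hω₀ hω (r := ((2 : ℝ) ^ (J + 1))⁻¹) (by positivity)
      (by simpa only [double] using integrable (mem_unit (J + 1)) (mem_unit J))
    rw [double] at last
    rw [Finset.sum_range_succ, ← intervalIntegral.integral_add_adjacent_intervals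
      (integrable (mem_unit (J + 1)) (mem_unit J)) (integrable (mem_unit J) ⟨zero_le_one, le_rfl⟩)]
    linarith

theorem IsSquareDini.of_integrableOn (hω₀ : ∀ t, 0 ≤ t → 0 ≤ ω t)
    (hω : MonotoneOn ω (Set.Ici 0))
    (hi : IntegrableOn (fun t => ω t ^ 2 / t) (Set.Ioc 0 1)) : IsSquareDini ω where
  nonneg := hω₀
  mono := hω
  summable := by
    refine (summable_nat_add_iff 1).1 (summable_of_sum_range_le
      (c := 2 * ∫ t in Set.Ioc (0 : ℝ) 1, ω t ^ 2 / t) (fun _ => sq_nonneg _) fun J => ?_)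
    refine (sum_sq_dyadic_le_integral hω₀ hω hi J).trans ?_
    have h₁ : ((2 : ℝ) ^ J)⁻¹ ≤ 1 := inv_le_one_of_one_le₀ (one_le_pow₀ one_le_two)
    rw [intervalIntegral.integral_of_le h₁]
    refine mul_le_mul_of_nonneg_left ?_ zero_le_two
    exact setIntegral_mono_set hi ((ae_restrict_iff' measurableSet_Ioc).2
      (Filter.Eventually.of_forall fun t ht => div_nonneg (sq_nonneg _) ht.1.le))
      (Set.Ioc_subset_Ioc_left (inv_nonneg.2 (pow_nonneg zero_le_two J))).eventuallyLE

end DiniIntegral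

section ChangeOfVariables

variable {n N : ℕ}

theorem bracket_le_bracket_smul {c : ℝ} (hc : 1 ≤ c) (ξ : EuclideanSpace ℝ (Fin n)) :
    bracket ξ ≤ bracket (c • ξ) := by
  have hc₀ : 0 ≤ c := zero_le_one.trans hc
  rw [bracket, bracket, norm_smul, Real.norm_of_nonneg hc₀]
  gcongr
  exact le_mul_of_one_le_left (norm_nonneg _) hc

theorem HasSymbolBound.comp_smul {E : Type*} [NormedAddCommGroup E] [NormedSpace ℝ E]
    {b : EuclideanSpace ℝ (Fin n) → E} {B c : ℝ} (hb : HasSymbolBound N b B) (hc : 1 ≤ c) :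
    HasSymbolBound N (fun η => b (c • η)) (c ^ N * B) where
  contDiff := hb.contDiff.comp (contDiff_const_smul c)
  norm_le ξ := (hb.norm_le _).trans (le_mul_of_one_le_left hb.nonneg (one_le_pow₀ hc))
  norm_partialD_le i k hk ξ := by
    have hB := hb.nonneg
    have hξ := one_le_bracket ξ
    have hcξ := bracket_le_bracket_smul hc ξ
    rw [iterate_partialD_comp_smul (hb.contDiff.of_le (by exact_mod_cast hk)), norm_smul,
      Real.norm_of_nonneg (by positivity)]
    calc c ^ k * ‖(partialD i)^[k] b (c • ξ)‖
        ≤ c ^ k * (B * (bracket (c • ξ) ^ k)⁻¹) := by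
          gcongr
          exact hb.norm_partialD_le i k hk (c • ξ)
      _ ≤ c ^ N * (B * (bracket ξ ^ k)⁻¹) := by
          have := hξ.trans hcξ
          gcongr
      _ = c ^ N * B * (bracket ξ ^ k)⁻¹ := (mul_assoc _ _ _).symm

theorem RoughSymbol.comp_smul {E : Type*} [NormedAddCommGroup E] [NormedSpace ℝ E]
    {b : EuclideanSpace ℝ (Fin n) → EuclideanSpace ℝ (Fin n) → E} {B c : ℝ} {ω : ℝ → ℝ}
    (hb : RoughSymbol N b B ω) (hc : 1 ≤ c) :
    RoughSymbol N (fun x η => b x (c • η)) (c ^ N * B) ω where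
  bound x := (hb.bound x).comp_smul hc
  modulus x x' := by
    rw [mul_assoc]
    exact (hb.modulus x x').comp_smul hc

variable {H : Type*} [NormedAddCommGroup H] [InnerProductSpace ℂ H]

theorem angularFourier_two_pi_smul (f : EuclideanSpace ℝ (Fin n) → H)
    (η : EuclideanSpace ℝ (Fin n)) : angularFourier f ((2 * Real.pi) • η) = 𝓕 f η := by
  rw [angularFourier, Real.fourier_eq']
  congr 1 with y
  rw [real_inner_smul_right]
  congr 2
  push_cast
  ring

theorem pseudoDiff_eq_multOp
    (σ : EuclideanSpace ℝ (Fin n) → EuclideanSpace ℝ (Fin n) → (H →L[ℂ] H))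
    (f : EuclideanSpace ℝ (Fin n) → H) (x : EuclideanSpace ℝ (Fin n)) :
    pseudoDiff σ f x = multOp (fun η => σ x ((2 * Real.pi) • η)) f x := by
  have rescale := Measure.integral_comp_smul (volume : Measure (EuclideanSpace ℝ (Fin n)))
    (fun ξ => Complex.exp (Complex.I * (inner ℝ x ξ : ℝ)) • σ x ξ (angularFourier f ξ))
    (2 * Real.pi)
  rw [finrank_euclideanSpace_fin, abs_of_pos (by positivity)] at rescale
  rw [pseudoDiff, ← rescale, multOp, Real.fourierInv_eq']
  congr 1 with η
  rw [angularFourier_two_pi_smul, real_inner_smul_right, real_inner_comm]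
  congr 2
  push_cast
  ring

end ChangeOfVariables

section MultiIndex

variable {n : ℕ}

theorem multiLength_zero : multiLength (0 : Fin n → ℕ) = 0 := by
  simp [multiLength]

theorem multiLength_single (i : Fin n) (k : ℕ) : multiLength (Pi.single i k) = k := by
  simp [multiLength]

theorem finite_setOf_multiLength_le (N : ℕ) : {α : Fin n → ℕ | multiLength α ≤ N}.Finite :=
  (Set.finite_Iic fun _ => N).subset fun _ hα i =>
    (Finset.single_le_sum (fun _ _ => Nat.zero_le _) (Finset.mem_univ i)).trans hα

theorem foldr_iterate_single {β : Type*} (D : Fin n → β → β) (i : Fin n) (k : ℕ) (f : β)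
    {l : List (Fin n)} (hl : l.Nodup) :
    l.foldr (fun j g => (D j)^[(Pi.single i k : Fin n → ℕ) j] g) f =
      if i ∈ l then (D i)^[k] f else f := by
  induction l with
  | nil => simp
  | cons j l ih =>
    rw [List.nodup_cons] at hl
    rw [List.foldr_cons, ih hl.2]
    rcases eq_or_ne i j with rfl | hij
    · simp [hl.1]
    · simp [hij, hij.symm]

variable {E : Type*} [NormedAddCommGroup E] [NormedSpace ℝ E]

theorem multiD_single (i : Fin n) (k : ℕ) (f : EuclideanSpace ℝ (Fin n) → E) :
    multiD (Pi.single i k) f = (partialD i)^[k] f := by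
  rw [multiD, foldr_iterate_single partialD i k f (List.nodup_finRange n),
    if_pos (List.mem_finRange i)]

theorem multiD_zero (f : EuclideanSpace ℝ (Fin n) → E) : multiD 0 f = f :=
  List.foldr_fixed _

theorem TimesDifferentiable.contDiff {k : ℕ} {f : EuclideanSpace ℝ (Fin n) → E}
    (hf : TimesDifferentiable (k + 1) f) : ContDiff ℝ k f :=
  contDiff_nat_iff_continuous_differentiable.2
    ⟨fun m hm => (hf m (Nat.lt_succ_of_le hm)).continuous, fun m hm => hf m (by omega)⟩

theorem exists_roughSymbol_of_multiD {N : ℕ}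
    {b : EuclideanSpace ℝ (Fin n) → EuclideanSpace ℝ (Fin n) → E} {ω : ℝ → ℝ}
    {C : (Fin n → ℕ) → ℝ} (hω : ∀ t, 0 ≤ t → 0 ≤ ω t) (hb : ∀ x, ContDiff ℝ N (b x))
    (bound : ∀ α : Fin n → ℕ, multiLength α ≤ N → ∀ x ξ,
      ‖multiD α (b x) ξ‖ ≤ C α * bracket ξ ^ (-(multiLength α : ℤ)))
    (modulus : ∀ α : Fin n → ℕ, multiLength α ≤ N → ∀ x x' ξ,
      ‖multiD α (b x) ξ - multiD α (b x') ξ‖ ≤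
        C α * bracket ξ ^ (-(multiLength α : ℤ)) * ω ‖x - x'‖) :
    ∃ B, RoughSymbol N b B ω := by
  obtain ⟨B, hB⟩ := ((finite_setOf_multiLength_le N).image C).bddAbove
  simp only [zpow_neg, zpow_natCast] at bound modulus
  have bound_le {α : Fin n → ℕ} (hα : multiLength α ≤ N) (x ξ) :
      ‖multiD α (b x) ξ‖ ≤ B * (bracket ξ ^ multiLength α)⁻¹ := by
    have hξ := one_le_bracket ξ
    have hC : C α ≤ B := hB ⟨α, hα, rfl⟩
    exact (bound α hα x ξ).trans (by gcongr)
  have modulus_le {α : Fin n → ℕ} (hα : multiLength α ≤ N) (x x' ξ) :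
      ‖multiD α (b x) ξ - multiD α (b x') ξ‖ ≤
        B * ω ‖x - x'‖ * (bracket ξ ^ multiLength α)⁻¹ := by
    have hξ := one_le_bracket ξ
    have hC : C α ≤ B := hB ⟨α, hα, rfl⟩
    have hωx := hω _ (norm_nonneg (x - x'))
    rw [mul_right_comm]
    exact (modulus α hα x x' ξ).trans (by gcongr)
  have zero_le : multiLength (0 : Fin n → ℕ) ≤ N := multiLength_zero.trans_le N.zero_le
  have single_le (i : Fin n) {k : ℕ} (hk : k ≤ N) : multiLength (Pi.single i k) ≤ N :=
    (multiLength_single i k).trans_le hk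
  refine ⟨B, fun x => ⟨hb x, fun ξ => ?_, fun i k hk ξ => ?_⟩,
    fun x x' => ⟨(hb x).sub (hb x'), fun ξ => ?_, fun i k hk ξ => ?_⟩⟩
  · simpa [multiD_zero, multiLength_zero] using bound_le zero_le x ξ
  · simpa only [multiD_single, multiLength_single] using bound_le (single_le i hk) x ξ
  · simpa [multiD_zero, multiLength_zero] using modulus_le zero_le x x' ξ
  · have hkN : (k : WithTop ℕ∞) ≤ N := by exact_mod_cast hk
    rw [iterate_partialD_sub ((hb x).of_le hkN) ((hb x').of_le hkN)]
    simpa only [multiD_single, multiLength_single] using modulus_le (single_le i hk) x x' ξ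

end MultiIndex

end

theorem theorem4p1_general {n N : ℕ} {H : Type*} [NormedAddCommGroup H] [InnerProductSpace ℂ H]
    [CompleteSpace H] {σ : EuclideanSpace ℝ (Fin n) → EuclideanSpace ℝ (Fin n) → (H →L[ℂ] H)}
    {B : ℝ} {ω : ℝ → ℝ} (hN : n < 2 * N) (hω : IsSquareDini ω) (hσ : RoughSymbol N σ B ω) :
    ∃ T : Lp H 2 (volume : Measure (EuclideanSpace ℝ (Fin n))) →L[ℂ]
        Lp H 2 (volume : Measure (EuclideanSpace ℝ (Fin n))),
      ∀ f : 𝓢(EuclideanSpace ℝ (Fin n), H), T (f.toLp 2) =ᵐ[volume] pseudoDiff σ f := by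
  have rescaled : RoughSymbol N (fun x η => σ x ((2 * Real.pi) • η)) ((2 * Real.pi) ^ N * B) ω :=
    hσ.comp_smul (by linarith [Real.pi_gt_three])
  obtain ⟨T, hT⟩ := rescaled.exists_continuousLinearMap_extending_multOp hN hω
  exact ⟨T, fun f => (hT f).trans
    (Filter.Eventually.of_forall fun x => (pseudoDiff_eq_multOp σ f x).symm)⟩

theorem theorem4p1 {n : ℕ} {H : Type*} [NormedAddCommGroup H] [InnerProductSpace ℂ H]
    [CompleteSpace H]
    (σ : EuclideanSpace ℝ (Fin n) → EuclideanSpace ℝ (Fin n) → (H →L[ℂ] H))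
    (ω : ℝ → ℝ) (C : (Fin n → ℕ) → ℝ)
    (hω_nonneg : ∀ t, 0 ≤ t → 0 ≤ ω t)
    (hω_mono : MonotoneOn ω (Set.Ici 0))
    (hω_dini : IntegrableOn (fun t => ω t ^ 2 / t) (Set.Ioc 0 1))
    (hσ_diff : ∀ x, TimesDifferentiable (n / 2 + 2) (σ x))
    (hσ_bound : ∀ α : Fin n → ℕ, multiLength α ≤ n / 2 + 2 → ∀ x ξ,
      ‖multiD α (σ x) ξ‖ ≤ C α * bracket ξ ^ (-(multiLength α : ℤ)))
    (hσ_mod : ∀ α : Fin n → ℕ, multiLength α ≤ n / 2 + 2 → ∀ x x' ξ,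
      ‖multiD α (σ x) ξ - multiD α (σ x') ξ‖ ≤
        C α * bracket ξ ^ (-(multiLength α : ℤ)) * ω ‖x - x'‖) :
    ∃ T : Lp H 2 (volume : Measure (EuclideanSpace ℝ (Fin n))) →L[ℂ]
        Lp H 2 (volume : Measure (EuclideanSpace ℝ (Fin n))),
      ∀ f : 𝓢(EuclideanSpace ℝ (Fin n), H), T (f.toLp 2) =ᵐ[volume] pseudoDiff σ f := by
  obtain ⟨B, hσ⟩ := exists_roughSymbol_of_multiD hω_nonneg (fun x => (hσ_diff x).contDiff)
    (fun α hα => hσ_bound α (by omega)) (fun α hα => hσ_mod α (by omega))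
  exact theorem4p1_general (by omega) (.of_integrableOn hω_nonneg hω_mono hω_dini) hσ
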